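/- Let $q$ be a square power of an odd prime, and let $\mathcal H$ be the Hermitian curve over $\mathbb F_q$, i.e. the plane curve $Y^{\sqrt q}Z+YZ^{\sqrt q}=X^{\sqrt q+1}$. Put $$G(X_0,X_1,X_2)=X_1^2X_2^{2\sqrt q}+X_0^2X_1^{2\sqrt q}+X_0^{2\sqrt q}X_2^2-2\bigl(X_0^{\sqrt q+1}X_1^{\sqrt q}X_2+X_0^{\sqrt q}X_1X_2^{\sqrt q+1}+X_0X_1^{\sqrt q+1}X_2^{\sqrt q}\bigr).$$ For a primitive $(q^2+q+1)$-th root of unity $a\in\mathbb F_{q^3}$ let $$M_a=\begin{pmatrix} a&1&a^{q+1}\\ a^{q+1}&a&1\\ 1&a^{q+1}&a\end{pmatrix},\qquad H(X,Y,Z)=G(aX+Y+a^{q+1}Z,\;a^{q+1}X+aY+Z,\;X+a^{q+1}Y+aZ).$$ There is such an $a$ with $M_a$ non-singular. For every such $a$ with $M_a$ non-singular, the equation $H(X,Y,Z)=0$ is a plane model over $\mathbb F_q$ of $\mathcal H$, of degree $2(\sqrt q+1)$. That is, $H=cF$ with $c\in\mathbb F_{q^3}$, $c\neq0$, and a form $F\in\mathbb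 F_q[X,Y,Z]$ of degree $2(\sqrt q+1)$; and $F$ and $\mathcal H$ are geometrically irreducible plane curves that are birationally equivalent over $\mathbb F_q$. The curve $F=0$ has a singular point over $\overline{\mathbb F}_q$. Moreover, regarded as a curve of the dual plane, $F=0$ is, for a suitable projectivity $T$ of $\mathbb P^2(\mathbb F_q)$, an algebraic envelope of $T(K)$. Here $\psi\in \mathrm{PGL}(3,q)$ is a collineation of order $q-\sqrt q+1$ that leaves $\mathcal H$ invariant, and $K\subset\mathbb P^2(\mathbb F_q)$ is an arc of $q-\sqrt q+1$ points (no three collinear) that is an orbit of $\langle\psi\rangle$. "Algebraic envelope" of an arc with $t=q+2-|K|$ tangents (lines meeting the arc in one point only) at each of its points means: a curve of degree $2t$ of the dual plane which meets the pencil of lines through each point of the arc exactly in the $t$ tangents at that point, each counted twice. -/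

import Mathlib

open MvPolynomial
open scoped LinearAlgebra.Projectivization MatrixGroups

namespace HermitianModel

noncomputable section

/-! ### Plane curves, rational maps and plane models -/

/-- A form `F` over `k` defines a plane curve over `k`: it is homogeneous and the curve `F = 0` is
geometrically irreducible (and reduced), i.e. `F` is irreducible over an algebraic closure. -/
structure IsPlaneCurve {k : Type*} [Field k] (F : MvPolynomial (Fin 3) k) : Prop where
  homogeneous : ∃ d : ℕ, F.IsHomogeneous d
  irreducible : Irreducible (MvPolynomial.map (algebraMap k (AlgebraicClosure k)) F)

/-- (A representative of) a rational map over `k` from the plane curve `F = 0` to the plane curve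
`G = 0`: three forms of the same degree over `k`, not all vanishing identically on `F = 0`,
such that `G` vanishes identically at their values on `F = 0`. -/
structure RationalMap {k : Type*} [Field k] (F G : MvPolynomial (Fin 3) k) where
  form : Fin 3 → MvPolynomial (Fin 3) k
  degree : ℕ
  homogeneous : ∀ i, (form i).IsHomogeneous degree
  defined : ∃ i, ¬ F ∣ form i
  maps : F ∣ bind₁ form G

/-- The composite `ψ ∘ φ` is defined as a rational map on the plane curve `F = 0` and is the
identity there. -/
def RationalMap.LeftInverse {k : Type*} [Field k] {F G : MvPolynomial (Fin 3) k}
    (ψ : RationalMap G F) (φ : RationalMap F G) : Prop :=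
  (∃ i, ¬ F ∣ bind₁ φ.form (ψ.form i)) ∧
    ∀ i j, F ∣ X i * bind₁ φ.form (ψ.form j) - X j * bind₁ φ.form (ψ.form i)

/-- The plane curve `F = 0` is a plane model over `k` of the plane curve `G = 0`: they are
birationally equivalent over `k`. -/
structure IsPlaneModel {k : Type*} [Field k] (F G : MvPolynomial (Fin 3) k) : Prop where
  curve_left : IsPlaneCurve F
  curve_right : IsPlaneCurve G
  birational : ∃ (φ : RationalMap F G) (ψ : RationalMap G F), ψ.LeftInverse φ ∧ φ.LeftInverse ψ

/-- The plane curve `F = 0` has a singular point (over an algebraic closure). -/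
def IsSingularCurve {k : Type*} [Field k] (F : MvPolynomial (Fin 3) k) : Prop :=
  ∃ P : Fin 3 → AlgebraicClosure k, P ≠ 0 ∧ aeval P F = 0 ∧ ∀ i, aeval P (pderiv i F) = 0

/-! ### The equations -/

/-- The Hermitian curve `Y ^ s * Z + Y * Z ^ s = X ^ (s + 1)`, where `s = √q`. -/
def hermitian (k : Type*) [Field k] (s : ℕ) : MvPolynomial (Fin 3) k :=
  X 1 ^ s * X 2 + X 1 * X 2 ^ s - X 0 ^ (s + 1)

/-- The polynomial `G` of degree `2 (√q + 1)`, where `s = √q`. -/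
def formG {R : Type*} [CommRing R] (s : ℕ) (x₀ x₁ x₂ : R) : R :=
  x₁ ^ 2 * x₂ ^ (2 * s) + x₀ ^ 2 * x₁ ^ (2 * s) + x₀ ^ (2 * s) * x₂ ^ 2
    - 2 * (x₀ ^ (s + 1) * x₁ ^ s * x₂ + x₀ ^ s * x₁ * x₂ ^ (s + 1) + x₀ * x₁ ^ (s + 1) * x₂ ^ s)

/-- The matrix of the change of frame. -/
def frameMatrix {L : Type*} [Field L] (q : ℕ) (a : L) : Matrix (Fin 3) (Fin 3) L :=
  !![a, 1, a ^ (q + 1); a ^ (q + 1), a, 1; 1, a ^ (q + 1), a]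

/-- `H(X,Y,Z) = G(aX + Y + a^{q+1}Z, a^{q+1}X + aY + Z, X + a^{q+1}Y + aZ)`, with `q = s ^ 2`. -/
def formH {L : Type*} [Field L] (s : ℕ) (a : L) : MvPolynomial (Fin 3) L :=
  formG s
    (C a * X 0 + X 1 + C (a ^ (s ^ 2 + 1)) * X 2)
    (C (a ^ (s ^ 2 + 1)) * X 0 + C a * X 1 + X 2)
    (X 0 + C (a ^ (s ^ 2 + 1)) * X 1 + C a * X 2)

/-! ### Arcs and algebraic envelopes

Both the points and the lines of the projective plane over `k` are given by homogeneous coordinate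
triples; a point and a line are incident when the triples are orthogonal. -/

/-- A set of points of the projective plane no three of which are collinear. -/
def IsArc {k : Type*} [Field k] (K : Set (ℙ k (Fin 3 → k))) : Prop :=
  ∀ l : ℙ k (Fin 3 → k), {P ∈ K | P.orthogonal l}.encard ≤ 2

/-- The tangents (unisecants) of `K` at `P`: the lines meeting `K` in `P` only. -/
def tangents {k : Type*} [Field k] (K : Set (ℙ k (Fin 3 → k))) (P : ℙ k (Fin 3 → k)) :
    Set (ℙ k (Fin 3 → k)) :=
  {l | {R ∈ K | R.orthogonal l} = {P}}

/-- The linear form in the line coordinates that vanishes at the lines through `P`. -/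
def pencilForm {k : Type*} [Field k] (P : ℙ k (Fin 3 → k)) : MvPolynomial (Fin 3) k :=
  ∑ i, C (P.rep i) * X i

/-- `F = 0`, as a curve of the dual plane, is an algebraic envelope of the arc `K` in the sense of
Segre's theorem for odd order: with `t = q + 2 - |K|` the number of tangents at each point of `K`,
`F` has degree `2 t` and, for every `P ∈ K`, the curve `F = 0` meets the pencil of lines
through `P` exactly in the tangents of `K` at `P`, each counted twice. On the pencil through `P`, a
linear form vanishing exactly at the line `l` is `pencilForm (Q l)` for any point `Q l ≠ P` of `l`;
equality on the pencil is congruence modulo `pencilForm P`. -/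
def IsAlgebraicEnvelope {k : Type*} [Field k] (K : Set (ℙ k (Fin 3 → k)))
    (F : MvPolynomial (Fin 3) k) : Prop :=
  ∃ t : ℕ, K.ncard + t = Nat.card k + 2 ∧ F ≠ 0 ∧ F.IsHomogeneous (2 * t) ∧
    ∀ P ∈ K, (tangents K P).ncard = t ∧
      ∃ (c : k) (Q : ℙ k (Fin 3 → k) → ℙ k (Fin 3 → k)), c ≠ 0 ∧
        (∀ l ∈ tangents K P, Q l ≠ P ∧ (Q l).orthogonal l) ∧
        pencilForm P ∣ F - C c * ∏ᶠ l ∈ tangents K P, pencilForm (Q l) ^ 2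

/-- `ψ` is a linear collineation of the plane over `k` that leaves the Hermitian curve invariant. -/
def PreservesHermitian {k : Type*} [Field k] (s : ℕ) (ψ : GL (Fin 3) k) : Prop :=
  ∃ c : k, c ≠ 0 ∧
    bind₁ (fun i => ∑ j, C (ψ i j) * X j) (hermitian k s) = C c * hermitian k s

/-- `F = 0` is, up to a projectivity `T` of the plane over `k`, an algebraic envelope of a
`ψ`-invariant arc, where `ψ` is a linear automorphism over `k`, of order `q - √q + 1`, of the
Hermitian curve and the arc is a `⟨ψ⟩`-orbit of `q - √q + 1` points (`s = √q`). -/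
def IsEnvelopeOfInvariantArc {k : Type*} [Field k] (s : ℕ) (F : MvPolynomial (Fin 3) k) : Prop :=
  ∃ (ψ T : GL (Fin 3) k) (K : Set (ℙ k (Fin 3 → k))),
    PreservesHermitian s ψ ∧
    orderOf (Matrix.ProjGenLinGroup.mk ψ) = s ^ 2 - s + 1 ∧
    (∃ P, K = MulAction.orbit (Subgroup.zpowers ψ) P) ∧
    IsArc K ∧ K.ncard = s ^ 2 - s + 1 ∧
    IsAlgebraicEnvelope ((fun P => T • P) '' K) F

end

end HermitianModel

/-!
Write `q = s ^ 2`. In the frame of a Singer cycle, i.e. in the coordinates `x`, `x ^ q` and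
`x ^ (q ^ 2)` on `L`, a nonsingular Hermitian form over `k` is given by the trace of
`x ^ (s ^ 3 + 1)`, so that the Hermitian curve becomes
`formU = x₁ x₂ ^ s + x₀ x₁ ^ s + x₀ ^ s x₂ = 0`
(`exists_hermitian_basis`, `map_hermitian_eq`). With `A`, `B`, `C` the three terms of `formU`,
`formG = A² + B² + C² - 2 A B - 2 B C - 2 C A`; hence `formG (x₀², x₁², x₂²)` is, by Heron's
factorization, the product of the four sign conjugates of `formU` (`formG_sq`).

*Plane model.* Since `formU` is irreducible by Eisenstein's criterion, and its sign conjugates are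
coprime, `formG ∣ f` holds exactly if `formU` divides `f (x₀², x₁², x₂²)` (`formG_dvd_iff`). This
makes `formG` irreducible, and reduces every congruence modulo `formG` to one modulo `formU`. The
coordinatewise squaring is thus a rational map from the curve of `formU` to that of `formG`. Its
inverse is given by `formP`: on `A + B + C = 0` one has `2 B C = A² - B² - C²`, which expresses a
monomial with odd exponents, and so the ratios of the coordinates, in their squares. Both maps
commute with the cyclic shift of the coordinates that the Frobenius automorphism induces, and
therefore descend to `k` (`exists_rationalMap_leftInverse`); so does the form `formG` itself. The
vertices of the frame are singular points.

The rows of `frameMatrix q a` are, up to a common factor `b` with `b ^ (q - 1) = a`, the conjugates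
of its first row (`exists_frame_eq`), so that `formH` is a multiple of `formG` in the frame of
conjugates of a basis of `L` over `k`.

*Envelope.* The elements `z` of `L` with `z ^ (s ^ 3 + 1) = 1` act by multiplication as unitary
maps, and their points are an orbit of `q - s + 1` points. The involution `z ↦ z ^ (s ^ 3)` inverts
these elements; together with the absence of quadratic elements in `L` this shows that no three of
the points are collinear (`proportional_of_dependent`), and that the tangents at the point `1` are
the lines `l` for which `x = l / l ^ q` satisfies `x ^ (s + 1) + x + 1 = 0` (`isTangent_of_root`,
`root_of_isTangent`). All `s + 1` roots of this polynomial lie in `L` and are simple. On the line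
`x₀ + x₁ + x₂ = 0` of the dual plane, which is the pencil of the point `1`, `formG` is the square of
`x₀ ^ (s + 1) + x₀ x₁ ^ s + x₁ ^ (s + 1)` (`formG_eq_sq`), which is the envelope condition at `1`
(`envelope_at_one`). The other points follow from the invariance of `formG` under the group.
-/

namespace HermitianModel

/-! ### Polynomials over a field extension -/

section Coefficientwise

variable {σ K E : Type*} [Field K] [Field E] [Algebra K E]

/-- A `K`-linear functional on an extension field `E` applied to every coefficient of a polynomial
over `E`. -/
noncomputable def coeffFunctional (r : E →ₗ[K] K) (p : MvPolynomial σ E) : MvPolynomial σ K :=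
  ∑ m ∈ p.support, monomial m (r (coeff m p))

theorem coeff_coeffFunctional (r : E →ₗ[K] K) (p : MvPolynomial σ E) (m : σ →₀ ℕ) :
    coeff m (coeffFunctional r p) = r (coeff m p) := by
  classical
  simp only [coeffFunctional, coeff_sum, coeff_monomial, Finset.sum_ite_eq', mem_support_iff]
  split_ifs with h
  · rfl
  · rw [not_not.1 h, map_zero]

theorem coeffFunctional_map_mul (r : E →ₗ[K] K) (f : MvPolynomial σ K) (h : MvPolynomial σ E) :
    coeffFunctional r (map (algebraMap K E) f * h) = f * coeffFunctional r h := by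
  classical
  ext m
  simp only [coeff_coeffFunctional, coeff_mul, coeff_map, map_sum]
  refine Finset.sum_congr rfl fun x _ => ?_
  rw [← Algebra.smul_def, map_smul, smul_eq_mul]

theorem coeffFunctional_map (r : E →ₗ[K] K) (f : MvPolynomial σ K) :
    coeffFunctional r (map (algebraMap K E) f) = C (r 1) * f := by
  ext m
  rw [coeff_coeffFunctional, coeff_map, coeff_C_mul, Algebra.algebraMap_eq_smul_one, map_smul,
    smul_eq_mul, mul_comm]

theorem coeffFunctional_sub (r : E →ₗ[K] K) (f g : MvPolynomial σ E) :
    coeffFunctional r (f - g) = coeffFunctional r f - coeffFunctional r g := by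
  ext m
  simp [coeff_coeffFunctional]

/-- Divisibility of polynomials descends along a field extension. -/
theorem dvd_of_map_dvd_map {f g : MvPolynomial σ K}
    (h : map (algebraMap K E) f ∣ map (algebraMap K E) g) : f ∣ g := by
  obtain ⟨r, hr⟩ := (Algebra.linearMap K E).exists_leftInverse_of_injective
    (LinearMap.ker_eq_bot.2 (algebraMap K E).injective)
  have hr1 : r 1 = 1 := by simpa using LinearMap.congr_fun hr 1
  obtain ⟨t, ht⟩ := h
  refine ⟨coeffFunctional r t, ?_⟩
  rw [← coeffFunctional_map_mul, ← ht, coeffFunctional_map, hr1, C_1, one_mul]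

/-- If `f ≡ c g` modulo `p` with `f`, `g`, `p` over `K` and `c` in an extension, and `p ∤ g`, then
`c` lies in `K`. -/
theorem exists_algebraMap_eq_of_dvd_sub {p f g : MvPolynomial σ K} {c : E}
    (h : map (algebraMap K E) p ∣ map (algebraMap K E) f - C c * map (algebraMap K E) g)
    (hg : ¬ p ∣ g) : ∃ d : K, algebraMap K E d = c ∧ p ∣ f - C d * g := by
  have hc : c ∈ Submodule.span K {(1 : E)} := by
    by_contra hc
    -- a functional that kills `K` and not `c` turns the congruence into `p ∣ g`
    obtain ⟨r, hrc, hr⟩ := Submodule.exists_le_ker_of_notMem hc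
    have hr1 : r 1 = 0 := hr (Submodule.mem_span_singleton_self 1)
    obtain ⟨t, ht⟩ := h
    have h1 := congrArg (coeffFunctional r) ht
    rw [coeffFunctional_map_mul, coeffFunctional_sub, coeffFunctional_map, hr1, C_0, zero_mul,
      mul_comm (C c), coeffFunctional_map_mul] at h1
    have h2 : coeffFunctional r (C c : MvPolynomial σ E) = C (r c) := by
      classical
      ext m
      rw [coeff_coeffFunctional, coeff_C, coeff_C]
      split_ifs
      · rfl
      · exact map_zero r
    rw [h2] at h1
    apply hg
    have h3 : p ∣ g * C (r c) := ⟨-coeffFunctional r t, by linear_combination -h1⟩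
    have h4 : IsUnit (C (r c) : MvPolynomial σ K) := (Ne.isUnit hrc).map C
    exact (IsUnit.dvd_mul_right h4).1 h3
  obtain ⟨d, rfl⟩ := Submodule.mem_span_singleton.1 hc
  refine ⟨d, Algebra.algebraMap_eq_smul_one d, dvd_of_map_dvd_map (E := E) ?_⟩
  simpa [Algebra.algebraMap_eq_smul_one] using h

end Coefficientwise

/-! ### Squaring the variables -/

section Contract

variable {σ K : Type*} [CommRing K]

/-- The `K`-linear left inverse of `expand 2` that keeps the monomials all of whose exponents are
even and halves these exponents. -/
noncomputable def contractTwo (p : MvPolynomial σ K) : MvPolynomial σ K :=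
  open Classical in
  ∑ m ∈ p.support.image (fun m => m.mapRange (· / 2) rfl), monomial m (coeff (2 • m) p)

theorem coeff_contractTwo (p : MvPolynomial σ K) (m : σ →₀ ℕ) :
    coeff m (contractTwo p) = coeff (2 • m) p := by
  classical
  simp only [contractTwo, coeff_sum, coeff_monomial, Finset.sum_ite_eq']
  split_ifs with h
  · rfl
  · by_contra h0
    refine h (Finset.mem_image.2 ⟨2 • m, mem_support_iff.2 (Ne.symm h0), ?_⟩)
    ext i
    simp

theorem contractTwo_expand_mul (f h : MvPolynomial σ K) :
    contractTwo (expand 2 f * h) = f * contractTwo h := by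
  classical
  induction f using MvPolynomial.induction_on' with
  | monomial d c =>
    ext m
    rw [coeff_contractTwo, expand_monomial, coeff_monomial_mul', coeff_monomial_mul',
      coeff_contractTwo]
    have h1 : 2 • d ≤ 2 • m ↔ d ≤ m := by simp [Finsupp.le_def]
    have h2 : 2 • m - 2 • d = 2 • (m - d) := by
      ext i
      simp [Nat.mul_sub]
    simp only [h1, h2]
  | add f g hf hg =>
    ext m
    rw [map_add, add_mul, add_mul, ← hf, ← hg]
    simp [coeff_contractTwo]

theorem dvd_of_expand_two_dvd {f g : MvPolynomial σ K} (h : expand 2 f ∣ expand 2 g) : f ∣ g := by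
  obtain ⟨t, ht⟩ := h
  refine ⟨contractTwo t, ?_⟩
  rw [← contractTwo_expand_mul, ← ht]
  ext m
  rw [coeff_contractTwo, coeff_expand_smul _ two_ne_zero]

end Contract

/-! ### Linear changes of variables -/

section Linear

variable {K : Type*} [CommRing K]

/-- The linear forms whose coefficients are the rows of a matrix. -/
noncomputable def linForm (M : Matrix (Fin 3) (Fin 3) K) (i : Fin 3) : MvPolynomial (Fin 3) K :=
  ∑ j, C (M i j) * X j

/-- The substitution of the linear forms of a matrix for the variables. -/
noncomputable def linSubst (M : Matrix (Fin 3) (Fin 3) K) :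
    MvPolynomial (Fin 3) K →ₐ[K] MvPolynomial (Fin 3) K :=
  bind₁ (linForm M)

@[simp]
theorem linSubst_X (M : Matrix (Fin 3) (Fin 3) K) (i : Fin 3) : linSubst M (X i) = linForm M i := by
  simp [linSubst]

theorem linSubst_linForm (M N : Matrix (Fin 3) (Fin 3) K) (i : Fin 3) :
    linSubst M (linForm N i) = linForm (N * M) i := by
  simp only [linForm, map_sum, map_mul, linSubst_X, algHom_C, algebraMap_eq, Matrix.mul_apply,
    Finset.mul_sum, Finset.sum_mul]
  rw [Finset.sum_comm]
  simp only [mul_assoc]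

theorem linForm_one (i : Fin 3) : linForm (1 : Matrix (Fin 3) (Fin 3) K) i = X i := by
  simp [linForm, Matrix.one_apply]

theorem linForm_diagonal (e : Fin 3 → K) (i : Fin 3) :
    linForm (Matrix.diagonal e) i = C (e i) * X i := by
  rw [linForm, Finset.sum_eq_single i]
  · rw [Matrix.diagonal_apply_eq]
  · intro j _ hj
    rw [Matrix.diagonal_apply_ne' _ hj, C_0, zero_mul]
  · simp

/-- An invertible linear change of variables. -/
noncomputable def linEquiv (M N : Matrix (Fin 3) (Fin 3) K) (h : M * N = 1) :
    MvPolynomial (Fin 3) K ≃ₐ[K] MvPolynomial (Fin 3) K :=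
  AlgEquiv.ofAlgHom (linSubst M) (linSubst N)
    (by ext i : 1; simp [linSubst_linForm, mul_eq_one_comm.1 h, linForm_one])
    (by ext i : 1; simp [linSubst_linForm, h, linForm_one])

theorem irreducible_linSubst {M N : Matrix (Fin 3) (Fin 3) K} (h : M * N = 1)
    {f : MvPolynomial (Fin 3) K} (hf : Irreducible f) : Irreducible (linSubst M f) :=
  (MulEquiv.irreducible_iff (linEquiv M N h)).2 hf

theorem dvd_of_linSubst_dvd {M N : Matrix (Fin 3) (Fin 3) K} (h : M * N = 1)
    {f g : MvPolynomial (Fin 3) K} (hf : linSubst M f ∣ linSubst M g) : f ∣ g :=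
  (map_dvd_iff (linEquiv M N h)).1 hf

theorem isHomogeneous_linForm (M : Matrix (Fin 3) (Fin 3) K) (i : Fin 3) :
    (linForm M i).IsHomogeneous 1 :=
  IsHomogeneous.sum _ _ _ fun j _ => by
    simpa using (isHomogeneous_C (Fin 3) (M i j)).mul (isHomogeneous_X K j)

end Linear

/-! ### The forms of the two curves and of the birational map -/

section Ring

variable {R S : Type*} [CommRing R] [CommRing S]

/-- The form `x₁ x₂ ^ s + x₀ x₁ ^ s + x₀ ^ s x₂`, which defines the Hermitian curve in the frame
of a Singer cycle. With `A`, `B`, `C` its three terms,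
`formG = A² + B² + C² - 2 A B - 2 B C - 2 C A`. -/
def formU (s : ℕ) (x₀ x₁ x₂ : R) : R :=
  x₁ * x₂ ^ s + x₀ * x₁ ^ s + x₀ ^ s * x₂

theorem map_formU {T : Type*} [FunLike T R S] [RingHomClass T R S] (f : T) (s : ℕ) (x₀ x₁ x₂ : R) :
    f (formU s x₀ x₁ x₂) = formU s (f x₀) (f x₁) (f x₂) := by
  simp [formU]

theorem map_formG {T : Type*} [FunLike T R S] [RingHomClass T R S] (f : T) (s : ℕ) (x₀ x₁ x₂ : R) :
    f (formG s x₀ x₁ x₂) = formG s (f x₀) (f x₁) (f x₂) := by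
  simp [formG, map_ofNat f 2]

theorem formU_cyclic (s : ℕ) (x₀ x₁ x₂ : R) : formU s x₁ x₂ x₀ = formU s x₀ x₁ x₂ := by
  simp only [formU]
  ring

theorem formG_cyclic (s : ℕ) (x₀ x₁ x₂ : R) : formG s x₁ x₂ x₀ = formG s x₀ x₁ x₂ := by
  simp only [formG]
  ring

theorem formU_smul (s : ℕ) (c x₀ x₁ x₂ : R) :
    formU s (c * x₀) (c * x₁) (c * x₂) = c ^ (s + 1) * formU s x₀ x₁ x₂ := by
  simp only [formU]
  ring

theorem formG_smul (s : ℕ) (c x₀ x₁ x₂ : R) :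
    formG s (c * x₀) (c * x₁) (c * x₂) = c ^ (2 * (s + 1)) * formG s x₀ x₁ x₂ := by
  simp only [formG]
  ring

/-- With squared variables `formG` is Heron's product of the sign conjugates of `formU`. -/
theorem formG_sq {s : ℕ} (hs : Odd s) (x₀ x₁ x₂ : R) :
    formG s (x₀ ^ 2) (x₁ ^ 2) (x₂ ^ 2) =
      formU s x₀ x₁ x₂ * (formU s (-x₀) x₁ x₂ * (formU s x₀ (-x₁) x₂ * formU s x₀ x₁ (-x₂))) := by
  simp only [formG, formU, hs.neg_pow]
  ring

/-- The forms inverting, up to a common factor, the coordinatewise squaring from the curve of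
`formU` to the curve of `formG`; here `s = 2 r + 1`. -/
def formP (r : ℕ) (x : Fin 3 → R) (i : Fin 3) : R :=
  x i * x (i + 1) * x (i + 2) ^ (r + 1) *
    (x (i + 1) * x (i + 2) ^ (2 * r + 1) - x i * x (i + 1) ^ (2 * r + 1)
      - x i ^ (2 * r + 1) * x (i + 2))

theorem map_formP {T : Type*} [FunLike T R S] [RingHomClass T R S] (f : T) (r : ℕ)
    (x : Fin 3 → R) (i : Fin 3) :
    f (formP r x i) = formP r (fun j => f (x j)) i := by
  simp [formP]

theorem formP_add_one (r : ℕ) (x : Fin 3 → R) (i : Fin 3) :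
    formP r x (i + 1) = formP r (fun j => x (j + 1)) i := by
  simp only [formP, add_assoc, add_comm (1 : Fin 3)]

/-- On the curve of `formU`, the forms `formP` at the squares of the coordinates are proportional to
the coordinates themselves. -/
theorem formU_dvd_formP_sub (r : ℕ) (u : Fin 3 → R) (i : Fin 3) :
    formU (2 * r + 1) (u 0) (u 1) (u 2) ∣
      formP r (fun j => u j ^ 2) i - 2 * (u 0 * u 1 * u 2) ^ (2 * r + 3) * u i := by
  have key : ∀ x₀ x₁ x₂ : R, formU (2 * r + 1) x₀ x₁ x₂ ∣
      x₀ ^ 2 * x₁ ^ 2 * (x₂ ^ 2) ^ (r + 1) *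
        (x₁ ^ 2 * (x₂ ^ 2) ^ (2 * r + 1) - x₀ ^ 2 * (x₁ ^ 2) ^ (2 * r + 1)
          - (x₀ ^ 2) ^ (2 * r + 1) * x₂ ^ 2) - 2 * (x₀ * x₁ * x₂) ^ (2 * r + 3) * x₀ := by
    intro x₀ x₁ x₂
    -- `α² - β² - γ² = 2 β γ + (α + β + γ) (α - β - γ)` for the three terms of `formU`
    refine ⟨x₀ ^ 2 * x₁ ^ 2 * (x₂ ^ 2) ^ (r + 1) *
      (x₁ * x₂ ^ (2 * r + 1) - x₀ * x₁ ^ (2 * r + 1) - x₀ ^ (2 * r + 1) * x₂), ?_⟩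
    simp only [formU]
    ring
  fin_cases i
  · exact key (u 0) (u 1) (u 2)
  · have := key (u 1) (u 2) (u 0)
    rw [formU_cyclic] at this
    convert this using 1
    simp only [formP, Fin.mk_one, Fin.isValue, Fin.reduceAdd]
    ring
  · have := key (u 2) (u 0) (u 1)
    rw [← formU_cyclic] at this
    convert this using 1
    change formP r (fun j => u j ^ 2) 2 - _ * u 2 = _
    simp only [formP, Fin.isValue, Fin.reduceAdd]
    ring

theorem formU_dvd_formU_formP (r : ℕ) (u : Fin 3 → R) :
    formU (2 * r + 1) (u 0) (u 1) (u 2) ∣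
      formU (2 * r + 1) (formP r (fun j => u j ^ 2) 0) (formP r (fun j => u j ^ 2) 1)
        (formP r (fun j => u j ^ 2) 2) := by
  have h := fun i => (Ideal.Quotient.mk_eq_mk_iff_sub_mem _ _).2
    (Ideal.mem_span_singleton.2 (formU_dvd_formP_sub r u i))
  rw [← Ideal.mem_span_singleton, ← Ideal.Quotient.eq_zero_iff_mem, map_formU, h, h, h,
    ← map_formU, formU_smul, Ideal.Quotient.eq_zero_iff_mem, Ideal.mem_span_singleton]
  exact dvd_mul_left _ _

theorem formU_dvd_cross (r : ℕ) (u : Fin 3 → R) (i j : Fin 3) :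
    formU (2 * r + 1) (u 0) (u 1) (u 2) ∣
      u i * formP r (fun j => u j ^ 2) j - u j * formP r (fun j => u j ^ 2) i := by
  convert ((formU_dvd_formP_sub r u j).mul_left (u i)).sub
    ((formU_dvd_formP_sub r u i).mul_left (u j)) using 1
  ring

end Ring

/-! ### Irreducibility -/

section Field

variable {E : Type*} [Field E] {s : ℕ}

/-- Eisenstein's criterion at the prime `x₁`, with respect to `x₀`. -/
theorem irreducible_formU (hs : 2 ≤ s) :
    Irreducible (formU s (X 0) (X 1) (X 2) : MvPolynomial (Fin 3) E) := by
  rw [← MulEquiv.irreducible_iff (finSuccEquiv E 2)]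
  set a : MvPolynomial (Fin 2) E := X 0 with ha
  set b : MvPolynomial (Fin 2) E := X 1 with hb
  have hab : ¬ a ∣ b := by
    rw [ha, hb, X_dvd_X]
    simp
  have hpa : Prime a := X_prime
  have h1 : finSuccEquiv E 2 (formU s (X 0) (X 1) (X 2)) =
      Polynomial.C b * Polynomial.X ^ s + Polynomial.C (a ^ s) * Polynomial.X
        + Polynomial.C (a * b ^ s) := by
    have e1 : finSuccEquiv E 2 (X 1) = Polynomial.C a := finSuccEquiv_X_succ (j := 0)
    have e2 : finSuccEquiv E 2 (X 2) = Polynomial.C b := finSuccEquiv_X_succ (j := 1)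
    simp only [formU, map_add, map_mul, map_pow, e1, e2, finSuccEquiv_X_zero]
    ring
  rw [h1]
  have hb0 : b ≠ 0 := X_ne_zero 1
  obtain ⟨d, hd⟩ : ∃ d, d = a ^ s := ⟨_, rfl⟩
  obtain ⟨e, he⟩ : ∃ e, e = a * b ^ s := ⟨_, rfl⟩
  rw [← hd, ← he]
  set f := Polynomial.C b * Polynomial.X ^ s + Polynomial.C d * Polynomial.X
        + Polynomial.C e with hf
  have hcoeff : ∀ n, f.coeff n = (if n = s then b else 0) + (if 1 = n then d else 0)
      + (if n = 0 then e else 0) := by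
    intro n
    simp [hf, Polynomial.coeff_X_pow, Polynomial.coeff_C, Polynomial.coeff_X]
  have hcs : f.coeff s = b := by
    simp [hcoeff, show s ≠ 0 by lia, show 1 ≠ s by lia]
  have hc0 : f.coeff 0 = a * b ^ s := by
    simp [hcoeff, show 0 ≠ s by lia, he]
  have hc1 : f.coeff 1 = a ^ s := by
    simp [hcoeff, show 1 ≠ s by lia, hd]
  have hdeg : f.natDegree = s := by
    refine Polynomial.natDegree_eq_of_le_of_coeff_ne_zero ?_ (hcs ▸ hb0)
    rw [hf]
    compute_degree!
    all_goals lia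
  have hf0 : f ≠ 0 := by
    intro h
    rw [h, Polynomial.coeff_zero] at hcs
    exact hb0 hcs.symm
  have hfd : f.degree = s := by rw [Polynomial.degree_eq_natDegree hf0, hdeg]
  refine Polynomial.irreducible_of_eisenstein_criterion
    ((Ideal.span_singleton_prime hpa.ne_zero).2 hpa) ?_ ?_ ?_ ?_ ?_
  · rw [Polynomial.leadingCoeff, hdeg, hcs, Ideal.mem_span_singleton]
    exact hab
  · intro n hn
    rw [hfd] at hn
    have hn' : n < s := by exact_mod_cast hn
    rw [Ideal.mem_span_singleton]
    rcases Nat.lt_or_ge n 2 with h | h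
    · interval_cases n
      · rw [hc0]
        exact dvd_mul_right _ _
      · rw [hc1]
        exact dvd_pow_self _ (by lia)
    · have : f.coeff n = 0 := by
        simp [hcoeff, show n ≠ s by lia, show 1 ≠ n by lia, show n ≠ 0 by lia]
      rw [this]
      exact dvd_zero _
  · rw [hfd]
    exact_mod_cast (by lia : 0 < s)
  · rw [hc0, Ideal.span_singleton_pow, Ideal.mem_span_singleton, pow_two]
    intro h
    exact hab (hpa.dvd_of_dvd_pow ((mul_dvd_mul_iff_left hpa.ne_zero).1 h))
  · intro c hc
    have h1 : c ∣ b := by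
      rw [← hcs]
      exact (Polynomial.C_dvd_iff_dvd_coeff _ _).1 hc s
    have h2 : c ∣ a ^ s := by
      rw [← hc1]
      exact (Polynomial.C_dvd_iff_dvd_coeff _ _).1 hc 1
    have h3 : IsRelPrime a b := (hpa.irreducible.isRelPrime_iff_not_dvd).2 hab
    exact h3.pow_left h2 h1

theorem irreducible_formU_signs (hs : 2 ≤ s) {e : Fin 3 → E} (he : ∀ i, e i * e i = 1) :
    Irreducible (formU s (C (e 0) * X 0) (C (e 1) * X 1) (C (e 2) * X 2) :
      MvPolynomial (Fin 3) E) := by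
  have h : Matrix.diagonal e * Matrix.diagonal e = 1 := by
    rw [Matrix.diagonal_mul_diagonal, ← Matrix.diagonal_one]
    exact congrArg _ (funext he)
  have h1 := irreducible_linSubst h (irreducible_formU (E := E) hs)
  rwa [map_formU, linSubst_X, linSubst_X, linSubst_X,
    linForm_diagonal, linForm_diagonal, linForm_diagonal] at h1

theorem not_dvd_X_of_eval_eq_zero {p : MvPolynomial (Fin 3) E} {i : Fin 3}
    (h : eval (Pi.single i 1) p = 0) : ¬ p ∣ X i := by
  intro hd
  have := map_dvd (eval (Pi.single i (1 : E))) hd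
  rw [h, eval_X, Pi.single_eq_same, zero_dvd_iff] at this
  exact one_ne_zero this

theorem isRelPrime_of_add_eq {p q : MvPolynomial (Fin 3) E} (hp : Irreducible p)
    (hv : ∀ i, eval (Pi.single i 1) p = 0) {c : E} (hc : c ≠ 0) {i j : Fin 3} {m n : ℕ}
    (h : p + q = C c * (X i ^ m * X j ^ n)) : IsRelPrime p q := by
  refine hp.isRelPrime_iff_not_dvd.2 fun hd => ?_
  have h1 : p ∣ C c * (X i ^ m * X j ^ n) := h ▸ (dvd_refl p).add hd
  have hu : IsUnit (C c : MvPolynomial (Fin 3) E) := (Ne.isUnit hc).map C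
  rw [IsUnit.dvd_mul_left hu] at h1
  rcases hp.prime.dvd_or_dvd h1 with h1 | h1
  · exact not_dvd_X_of_eval_eq_zero (hv i) (hp.prime.dvd_of_dvd_pow h1)
  · exact not_dvd_X_of_eval_eq_zero (hv j) (hp.prime.dvd_of_dvd_pow h1)

variable (hs : Odd s) (hs2 : 2 ≤ s) (h2 : (2 : E) ≠ 0)
include hs hs2 h2

/-- A polynomial in the squares of the variables that is divisible by `formU` is divisible by its
sign conjugates, which are pairwise coprime, and so by their product. -/
theorem formG_dvd_of_formU_dvd_expand {f : MvPolynomial (Fin 3) E}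
    (h : formU s (X 0) (X 1) (X 2) ∣ expand 2 f) : formG s (X 0) (X 1) (X 2) ∣ f := by
  apply dvd_of_expand_two_dvd
  rw [map_formG, expand_X, expand_X, expand_X, formG_sq hs]
  have hs0 : s ≠ 0 := by lia
  -- the four sign conjugates, as forms with `±1` as coefficients
  have hconj : ∀ e : Fin 3 → E, (∀ i, e i * e i = 1) →
      formU s (C (e 0) * X 0) (C (e 1) * X 1) (C (e 2) * X 2) ∣ expand 2 f := by
    intro e he
    have h1 := map_dvd (linSubst (Matrix.diagonal e)) h
    have h4 : linSubst (Matrix.diagonal e) (expand 2 f) = expand 2 f := by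
      have : (linSubst (Matrix.diagonal e)).comp (expand 2) = expand 2 := by
        ext i : 1
        simp only [AlgHom.comp_apply, expand_X, map_pow, linSubst_X, linForm_diagonal]
        rw [mul_pow, ← C_pow, pow_two, he, C_1, one_mul]
      exact DFunLike.congr_fun this f
    rwa [h4, map_formU, linSubst_X, linSubst_X, linSubst_X,
      linForm_diagonal, linForm_diagonal, linForm_diagonal] at h1
  have sgn : ∀ i j : Fin 3, (Pi.mulSingle i (-1) : Fin 3 → E) j *
      (Pi.mulSingle i (-1) : Fin 3 → E) j = 1 := by
    intro i j
    rcases eq_or_ne j i with rfl | hij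
    · simp
    · simp [hij]
  have i0 := irreducible_formU (E := E) hs2
  have i1 := irreducible_formU_signs (E := E) hs2 (sgn 0)
  have i2 := irreducible_formU_signs (E := E) hs2 (sgn 1)
  have i3 := irreducible_formU_signs (E := E) hs2 (sgn 2)
  have d1 := hconj _ (sgn 0)
  have d2 := hconj _ (sgn 1)
  have d3 := hconj _ (sgn 2)
  simp only [Pi.mulSingle_apply, Fin.isValue, Fin.reduceEq, if_true, if_false, C_1, one_mul,
    C_neg, neg_mul] at i1 i2 i3 d1 d2 d3
  have e0 : ∀ i, eval (Pi.single i 1) (formU s (X 0) (X 1) (X 2) : MvPolynomial (Fin 3) E) = 0 := by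
    intro i
    fin_cases i <;> simp [formU, hs0]
  have e1 : ∀ i, eval (Pi.single i 1)
      (formU s (-X 0) (X 1) (X 2) : MvPolynomial (Fin 3) E) = 0 := by
    intro i
    fin_cases i <;> simp [formU, hs0]
  have e2 : ∀ i, eval (Pi.single i 1)
      (formU s (X 0) (-X 1) (X 2) : MvPolynomial (Fin 3) E) = 0 := by
    intro i
    fin_cases i <;> simp [formU, hs0]
  have h2' : (-2 : E) ≠ 0 := neg_ne_zero.2 h2
  have hC2 : (C 2 : MvPolynomial (Fin 3) E) = 2 := rfl
  refine IsRelPrime.mul_dvd ?_ h (IsRelPrime.mul_dvd ?_ d1 (IsRelPrime.mul_dvd ?_ d2 d3))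
  · refine IsRelPrime.mul_right ?_ (IsRelPrime.mul_right ?_ ?_)
    · refine isRelPrime_of_add_eq i0 e0 h2 (i := 1) (j := 2) (m := 1) (n := s) ?_
      simp only [formU, hs.neg_pow, hC2]
      ring
    · refine isRelPrime_of_add_eq i0 e0 h2 (i := 0) (j := 2) (m := s) (n := 1) ?_
      simp only [formU, hs.neg_pow, hC2]
      ring
    · refine isRelPrime_of_add_eq i0 e0 h2 (i := 0) (j := 1) (m := 1) (n := s) ?_
      simp only [formU, hs.neg_pow, hC2]
      ring
  · refine IsRelPrime.mul_right ?_ ?_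
    · refine isRelPrime_of_add_eq i1 e1 h2' (i := 0) (j := 1) (m := 1) (n := s) ?_
      simp only [formU, hs.neg_pow, C_neg, hC2]
      ring
    · refine isRelPrime_of_add_eq i1 e1 h2' (i := 0) (j := 2) (m := s) (n := 1) ?_
      simp only [formU, hs.neg_pow, C_neg, hC2]
      ring
  · refine isRelPrime_of_add_eq i2 e2 h2' (i := 1) (j := 2) (m := 1) (n := s) ?_
    simp only [formU, hs.neg_pow, C_neg, hC2]
    ring

/-- Divisibility by `formG` is divisibility by `formU` after squaring the variables: the ideal of
the curve of `formG` is the contraction of the ideal of the curve of `formU`. -/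
theorem formG_dvd_iff {f : MvPolynomial (Fin 3) E} :
    formG s (X 0) (X 1) (X 2) ∣ f ↔ formU s (X 0) (X 1) (X 2) ∣ expand 2 f := by
  refine ⟨fun h => ?_, formG_dvd_of_formU_dvd_expand hs hs2 h2⟩
  have h1 := map_dvd (expand 2) h
  rw [map_formG, expand_X, expand_X, expand_X, formG_sq hs]
    at h1
  exact (dvd_mul_right _ _).trans h1

/-- As a contraction of a prime ideal, the ideal of `formG` is prime. -/
theorem irreducible_formG : Irreducible (formG s (X 0) (X 1) (X 2) : MvPolynomial (Fin 3) E) := by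
  have hU := irreducible_formU (E := E) hs2
  refine Prime.irreducible ⟨?_, ?_, fun f g hfg => ?_⟩
  · intro h0
    have h1 := congrArg (eval (![1, 1, 0] : Fin 3 → E)) h0
    simp [formG, show s ≠ 0 by lia] at h1
  · intro h0
    have h1 := (formG_dvd_iff (f := (1 : MvPolynomial (Fin 3) E)) hs hs2 h2).1 h0.dvd
    rw [map_one] at h1
    exact hU.not_isUnit (isUnit_of_dvd_one h1)
  · rw [formG_dvd_iff hs hs2 h2, formG_dvd_iff hs hs2 h2]
    rw [formG_dvd_iff hs hs2 h2, map_mul] at hfg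
    exact hU.prime.dvd_or_dvd hfg

omit hs h2 in
theorem not_formU_dvd_X (i : Fin 3) :
    ¬ (formU s (X 0) (X 1) (X 2) : MvPolynomial (Fin 3) E) ∣ X i := by
  refine not_dvd_X_of_eval_eq_zero ?_
  fin_cases i <;> simp [formU, show s ≠ 0 by lia]

end Field

/-! ### The inverse of the coordinatewise squaring -/

section Birational

variable {E : Type*} [Field E] {r : ℕ}

theorem expand_formP (i : Fin 3) :
    expand 2 (formP r (X : Fin 3 → MvPolynomial (Fin 3) E) i) = formP r (fun j => X j ^ 2) i := by
  rw [map_formP]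
  simp

variable (hr : 1 ≤ r) (h2 : (2 : E) ≠ 0)
include hr h2

theorem formG_dvd_formU_formP :
    (formG (2 * r + 1) (X 0) (X 1) (X 2) : MvPolynomial (Fin 3) E) ∣
      formU (2 * r + 1) (formP r X 0) (formP r X 1) (formP r X 2) := by
  rw [formG_dvd_iff ⟨r, rfl⟩ (by lia) h2, map_formU]
  simp only [expand_formP]
  exact formU_dvd_formU_formP r X

theorem formG_dvd_cross (i j : Fin 3) :
    (formG (2 * r + 1) (X 0) (X 1) (X 2) : MvPolynomial (Fin 3) E) ∣
      X i * formP r X j ^ 2 - X j * formP r X i ^ 2 := by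
  rw [formG_dvd_iff ⟨r, rfl⟩ (by lia) h2]
  simp only [map_sub, map_mul, map_pow, expand_formP, expand_X]
  convert (formU_dvd_cross r (X : Fin 3 → MvPolynomial (Fin 3) E) i j).mul_right
    (X i * formP r (fun j => X j ^ 2) j + X j * formP r (fun j => X j ^ 2) i) using 1
  ring

theorem not_formU_dvd_formP (i : Fin 3) :
    ¬ (formU (2 * r + 1) (X 0) (X 1) (X 2) : MvPolynomial (Fin 3) E) ∣
      formP r (fun j => X j ^ 2) i := by
  intro h
  have hp := (irreducible_formU (E := E) (s := 2 * r + 1) (by lia)).prime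
  have hX := not_formU_dvd_X (E := E) (s := 2 * r + 1) (by lia)
  have h1 := (dvd_sub_right h).1 (formU_dvd_formP_sub r (X : Fin 3 → MvPolynomial (Fin 3) E) i)
  have hC2 : (C 2 : MvPolynomial (Fin 3) E) = 2 := rfl
  rw [← hC2, mul_assoc, IsUnit.dvd_mul_left ((Ne.isUnit h2).map C)] at h1
  rcases hp.dvd_or_dvd h1 with h1 | h1
  · rcases hp.dvd_or_dvd (hp.dvd_of_dvd_pow h1) with h1 | h1
    · rcases hp.dvd_or_dvd h1 with h1 | h1
      · exact hX 0 h1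
      · exact hX 1 h1
    · exact hX 2 h1
  · exact hX i h1

theorem not_formG_dvd_formP (i : Fin 3) :
    ¬ (formG (2 * r + 1) (X 0) (X 1) (X 2) : MvPolynomial (Fin 3) E) ∣ formP r X i := by
  rw [formG_dvd_iff ⟨r, rfl⟩ (by lia) h2, expand_formP]
  exact not_formU_dvd_formP hr h2 i

end Birational

/-! ### Descent of the birational map to the ground field -/

section Combination

variable {L : Type*} [Field L] {M M' : Matrix (Fin 3) (Fin 3) L}

theorem sum_C_mul_sum_C (h : M * M' = 1) (w : Fin 3 → MvPolynomial (Fin 3) L) (i : Fin 3) :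
    ∑ j, C (M i j) * ∑ l, C (M' j l) * w l = w i := by
  have h1 : ∀ l, ∑ j, M i j * M' j l = if i = l then 1 else 0 := by
    intro l
    rw [← Matrix.mul_apply, h, Matrix.one_apply]
  simp only [Finset.mul_sum]
  rw [Finset.sum_comm]
  simp only [← mul_assoc, ← Finset.sum_mul, ← C_mul]
  simp only [← map_sum, h1]
  simp [apply_ite C]

theorem bind₁_linForm (M : Matrix (Fin 3) (Fin 3) L) (g : Fin 3 → MvPolynomial (Fin 3) L)
    (i : Fin 3) : bind₁ g (linForm M i) = ∑ j, C (M i j) * g j := by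
  simp [linForm, algebraMap_eq]

theorem dvd_of_forall_dvd_sum_C (h : M * M' = 1) {d : MvPolynomial (Fin 3) L}
    {w : Fin 3 → MvPolynomial (Fin 3) L} (hd : ∀ j, d ∣ ∑ l, C (M' j l) * w l) (i : Fin 3) :
    d ∣ w i := by
  rw [← sum_C_mul_sum_C h w i]
  exact Finset.dvd_sum fun j _ => (hd j).mul_left _

theorem dvd_cross_sum_C (M' : Matrix (Fin 3) (Fin 3) L) {d : MvPolynomial (Fin 3) L}
    {t w : Fin 3 → MvPolynomial (Fin 3) L} (hd : ∀ a b, d ∣ t a * w b - t b * w a) (i j : Fin 3) :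
    d ∣ (∑ l, C (M' i l) * t l) * (∑ l, C (M' j l) * w l)
      - (∑ l, C (M' j l) * t l) * (∑ l, C (M' i l) * w l) := by
  have h1 : (∑ l, C (M' i l) * t l) * (∑ l, C (M' j l) * w l)
      - (∑ l, C (M' j l) * t l) * (∑ l, C (M' i l) * w l) =
      ∑ a, ∑ b, C (M' i a) * C (M' j b) * (t a * w b - t b * w a) := by
    rw [mul_comm (∑ l, C (M' j l) * t l)]
    simp only [Finset.sum_mul_sum, ← Finset.sum_sub_distrib]
    refine Finset.sum_congr rfl fun a _ => Finset.sum_congr rfl fun b _ => ?_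
    ring
  rw [h1]
  exact Finset.dvd_sum fun a _ => Finset.dvd_sum fun b _ => (hd a b).mul_left _

end Combination

section Semilinear

variable {k L : Type*} [Field k] [Field L] [Algebra k L]

/-- A matrix whose rows are permuted cyclically by a field endomorphism `τ`: if `τ` is the
Frobenius map, the rows are the conjugates of a linear form, so that the matrix is the change of
frame from the standard one to the frame of a Singer cycle. -/
def IsCyclicFrame (τ : L →ₐ[k] L) (N : Matrix (Fin 3) (Fin 3) L) : Prop :=
  ∀ i j, τ (N i j) = N (i + 1) j

variable {τ : L →ₐ[k] L}

theorem IsCyclicFrame.inv {N N' : Matrix (Fin 3) (Fin 3) L} (hN : IsCyclicFrame τ N)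
    (h : N * N' = 1) (j i : Fin 3) : τ (N' j i) = N' j (i + 1) := by
  have h' := mul_eq_one_comm.1 h
  have h1 : (Matrix.of fun j i => τ (N' j (i - 1))) * N = 1 := by
    ext j l
    have h2 := congrArg τ (congrFun (congrFun h' j) l)
    rw [Matrix.mul_apply, map_sum] at h2
    rw [Matrix.mul_apply, ← Equiv.sum_comp (Equiv.addRight (1 : Fin 3))]
    simp only [Matrix.of_apply, Equiv.coe_addRight, add_sub_cancel_right, ← hN _ _, ← map_mul]
    rw [h2, Matrix.one_apply, apply_ite τ, map_one, map_zero]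
  have h3 : (Matrix.of fun j i => τ (N' j (i - 1))) = N' := by
    rw [← mul_one (Matrix.of fun j i => τ (N' j (i - 1))), ← h, ← mul_assoc, h1, one_mul]
  have h4 := congrFun (congrFun h3 j) (i + 1)
  rwa [Matrix.of_apply, add_sub_cancel_right] at h4

theorem IsCyclicFrame.map_linForm {N : Matrix (Fin 3) (Fin 3) L} (hN : IsCyclicFrame τ N)
    (i : Fin 3) : map (τ : L →+* L) (linForm N i) = linForm N (i + 1) := by
  simp [linForm, hN i]

/-- A polynomial fixed by the automorphism has its coefficients in the fixed field. -/
theorem exists_map_eq_of_fixed (hτ : ∀ x : L, τ x = x → x ∈ (algebraMap k L).range)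
    {p : MvPolynomial (Fin 3) L} (hp : map (τ : L →+* L) p = p) :
    ∃ f : MvPolynomial (Fin 3) k, map (algebraMap k L) f = p := by
  have : p ∈ Set.range (map (algebraMap k L) : MvPolynomial (Fin 3) k →+* _) := by
    rw [mem_range_map_iff_coeffs_subset]
    intro x hx
    obtain ⟨m, -, rfl⟩ := mem_coeffs_iff.1 hx
    apply hτ
    conv_rhs => rw [← hp]
    rw [coeff_map]
    rfl
  exact this

theorem IsCyclicFrame.exists_map_eq_sum {N N' : Matrix (Fin 3) (Fin 3) L}
    (hτ : ∀ x : L, τ x = x → x ∈ (algebraMap k L).range) (hN : IsCyclicFrame τ N)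
    (h : N * N' = 1) {w : Fin 3 → MvPolynomial (Fin 3) L}
    (hw : ∀ i, map (τ : L →+* L) (w i) = w (i + 1)) :
    ∃ g : Fin 3 → MvPolynomial (Fin 3) k, ∀ j, map (algebraMap k L) (g j) =
      ∑ i, C (N' j i) * w i := by
  have : ∀ j, ∃ f : MvPolynomial (Fin 3) k, map (algebraMap k L) f = ∑ i, C (N' j i) * w i := by
    intro j
    apply exists_map_eq_of_fixed hτ
    have h1 : ∀ i, (τ : L →+* L) (N' j i) = N' j (i + 1) := hN.inv h j
    simp only [map_sum, map_mul, map_C, hw, h1]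
    exact Equiv.sum_comp (Equiv.addRight (1 : Fin 3)) fun i => C (N' j i) * w i
  choose g hg using this
  exact ⟨g, hg⟩

theorem isHomogeneous_of_map_sum {g : Fin 3 → MvPolynomial (Fin 3) k}
    {N' : Matrix (Fin 3) (Fin 3) L} {w : Fin 3 → MvPolynomial (Fin 3) L}
    (hg : ∀ j, map (algebraMap k L) (g j) = ∑ i, C (N' j i) * w i) {n : ℕ}
    (hw : ∀ i, (w i).IsHomogeneous n) (j : Fin 3) : (g j).IsHomogeneous n := by
  apply IsHomogeneous.of_map (algebraMap k L).injective
  rw [hg]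
  refine IsHomogeneous.sum _ _ _ fun i _ => ?_
  simpa using (isHomogeneous_C (Fin 3) (N' j i)).mul (hw i)

end Semilinear

theorem isHomogeneous_formP {L : Type*} [Field L] {r : ℕ} {x : Fin 3 → MvPolynomial (Fin 3) L}
    (hx : ∀ i, (x i).IsHomogeneous 1) (i : Fin 3) : (formP r x i).IsHomogeneous (3 * r + 5) := by
  have h1 : ∀ {a b : MvPolynomial (Fin 3) L} {n : ℕ}, a.IsHomogeneous 1 → b.IsHomogeneous 1 →
      (a * b ^ n).IsHomogeneous (n + 1) := by
    intro a b n ha hb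
    have := ha.mul (hb.pow n)
    rwa [one_mul, add_comm] at this
  have h2 : x i ^ (2 * r + 1) * x (i + 2) = x (i + 2) * x i ^ (2 * r + 1) := mul_comm _ _
  rw [formP, h2]
  have h3 := (((hx i).mul (hx (i + 1))).mul ((hx (i + 2)).pow (r + 1))).mul
    (((h1 (hx (i + 1)) (hx (i + 2))).sub (h1 (n := 2 * r + 1) (hx i) (hx (i + 1)))).sub
      (h1 (hx (i + 2)) (hx i)))
  convert h3 using 1
  ring

section PlaneModel

variable {k L : Type*} [Field k] [Field L] [Algebra k L] {τ : L →ₐ[k] L} {r : ℕ}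
  {F H : MvPolynomial (Fin 3) k} {M M' N N' : Matrix (Fin 3) (Fin 3) L}

theorem linSubst_formG (N : Matrix (Fin 3) (Fin 3) L) (s : ℕ) :
    linSubst N (formG s (X 0) (X 1) (X 2)) =
      formG s (linForm N 0) (linForm N 1) (linForm N 2) := by
  rw [map_formG]
  simp

theorem linSubst_formU (N : Matrix (Fin 3) (Fin 3) L) (s : ℕ) :
    linSubst N (formU s (X 0) (X 1) (X 2)) =
      formU s (linForm N 0) (linForm N 1) (linForm N 2) := by
  rw [map_formU]
  simp

theorem linSubst_formP (N : Matrix (Fin 3) (Fin 3) L) (r : ℕ) (i : Fin 3) :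
    linSubst N (formP r X i) = formP r (linForm N) i := by
  rw [map_formP]
  simp

theorem linSubst_formP_sq (N : Matrix (Fin 3) (Fin 3) L) (r : ℕ) (i : Fin 3) :
    linSubst N (formP r (fun j => X j ^ 2) i) = formP r (fun j => linForm N j ^ 2) i := by
  rw [map_formP]
  simp

/-- Squaring the coordinates in the frame of a Singer cycle is a birational map defined over the
fixed field, from the curve of `formU` onto the curve of `formG`. -/
theorem exists_rationalMap_leftInverse (hr : 1 ≤ r) (h2 : (2 : L) ≠ 0)
    (hτ : ∀ x : L, τ x = x → x ∈ (algebraMap k L).range)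
    (hM : IsCyclicFrame τ M) (hMM : M * M' = 1) (hN : IsCyclicFrame τ N) (hNN : N * N' = 1)
    (hF : map (algebraMap k L) F = formG (2 * r + 1) (linForm N 0) (linForm N 1) (linForm N 2))
    (hH : map (algebraMap k L) H = formU (2 * r + 1) (linForm M 0) (linForm M 1) (linForm M 2)) :
    ∃ (φ : RationalMap F H) (ψ : RationalMap H F), ψ.LeftInverse φ ∧ φ.LeftInverse ψ := by
  have hMM' := mul_eq_one_comm.1 hMM
  have hNN' := mul_eq_one_comm.1 hNN
  have hF' : map (algebraMap k L) F = linSubst N (formG (2 * r + 1) (X 0) (X 1) (X 2)) := by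
    rw [hF, linSubst_formG]
  have hH' : map (algebraMap k L) H = linSubst M (formU (2 * r + 1) (X 0) (X 1) (X 2)) := by
    rw [hH, linSubst_formU]
  obtain ⟨f, hf⟩ := hM.exists_map_eq_sum hτ hMM (w := formP r (linForm N)) (by
    intro i
    rw [map_formP, formP_add_one]
    simp only [hN.map_linForm])
  obtain ⟨g, hg⟩ := hN.exists_map_eq_sum hτ hNN (w := fun i => linForm M i ^ 2) (by
    intro i
    rw [map_pow, hM.map_linForm])
  -- the maps in the coordinates of the frames
  have hMf : ∀ i, bind₁ (fun j => map (algebraMap k L) (f j)) (linForm M i) =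
      formP r (linForm N) i := by
    intro i
    rw [bind₁_linForm]
    simp only [hf]
    exact sum_C_mul_sum_C hMM _ i
  have hNg : ∀ i, bind₁ (fun j => map (algebraMap k L) (g j)) (linForm N i) =
      linForm M i ^ 2 := by
    intro i
    rw [bind₁_linForm]
    simp only [hg]
    exact sum_C_mul_sum_C hNN _ i
  have hgf : ∀ j, map (algebraMap k L) (bind₁ f (g j)) =
      ∑ l, C (N' j l) * formP r (linForm N) l ^ 2 := by
    intro j
    rw [map_bind₁, hg]
    simp only [map_sum, map_mul, map_pow, hMf, algHom_C, algebraMap_eq]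
  have hfg : ∀ j, map (algebraMap k L) (bind₁ g (f j)) =
      ∑ l, C (M' j l) * formP r (fun i => linForm M i ^ 2) l := by
    intro j
    rw [map_bind₁, hf]
    simp only [map_sum, map_mul, algHom_C, algebraMap_eq]
    refine Finset.sum_congr rfl fun l _ => ?_
    rw [map_formP]
    simp only [hNg]
  have hXN : ∀ i, (X i : MvPolynomial (Fin 3) L) = ∑ l, C (N' i l) * linForm N l := by
    intro i
    rw [← sum_C_mul_sum_C hNN' X i]
    rfl
  have hXM : ∀ i, (X i : MvPolynomial (Fin 3) L) = ∑ l, C (M' i l) * linForm M l := by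
    intro i
    rw [← sum_C_mul_sum_C hMM' X i]
    rfl
  have hGprime : Prime (formG (2 * r + 1) (X 0) (X 1) (X 2) : MvPolynomial (Fin 3) L) :=
    (irreducible_formG ⟨r, rfl⟩ (by lia) h2).prime
  have hGP : ∀ i, ¬ map (algebraMap k L) F ∣ formP r (linForm N) i := by
    intro i h
    rw [hF', ← linSubst_formP] at h
    exact not_formG_dvd_formP hr h2 i (dvd_of_linSubst_dvd hNN h)
  have hGP2 : ∀ i, ¬ map (algebraMap k L) F ∣ formP r (linForm N) i ^ 2 := by
    intro i h
    rw [hF', ← linSubst_formP, ← map_pow] at h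
    exact not_formG_dvd_formP hr h2 i (hGprime.dvd_of_dvd_pow (dvd_of_linSubst_dvd hNN h))
  have hUX : ∀ i, ¬ map (algebraMap k L) H ∣ linForm M i ^ 2 := by
    intro i h
    rw [hH', ← linSubst_X, ← map_pow] at h
    exact not_formU_dvd_X (by lia) i
      ((irreducible_formU (by lia)).prime.dvd_of_dvd_pow (dvd_of_linSubst_dvd hMM h))
  have hUP : ∀ i, ¬ map (algebraMap k L) H ∣ formP r (fun j => linForm M j ^ 2) i := by
    intro i h
    rw [hH', ← linSubst_formP_sq] at h
    exact not_formU_dvd_formP hr h2 i (dvd_of_linSubst_dvd hMM h)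
  refine ⟨⟨f, 3 * r + 5, isHomogeneous_of_map_sum hf
      (isHomogeneous_formP (isHomogeneous_linForm N)), ?_, ?_⟩,
    ⟨g, 2, isHomogeneous_of_map_sum hg (fun i => ?_), ?_, ?_⟩, ⟨?_, ?_⟩, ⟨?_, ?_⟩⟩
  · by_contra! h
    refine hGP 0 (dvd_of_forall_dvd_sum_C hMM (fun j => ?_) 0)
    rw [← hf]
    exact map_dvd _ (h j)
  · apply dvd_of_map_dvd_map (E := L)
    rw [map_bind₁, hH, map_formU, hMf, hMf, hMf, hF',
      ← linSubst_formP, ← linSubst_formP, ← linSubst_formP]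
    have h := map_dvd (linSubst N) (formG_dvd_formU_formP (E := L) hr h2)
    rwa [map_formU] at h
  · simpa using (isHomogeneous_linForm M i).pow 2
  · by_contra! h
    refine hUX 0 (dvd_of_forall_dvd_sum_C hNN (w := fun i => linForm M i ^ 2) (fun j => ?_) 0)
    rw [← hg]
    exact map_dvd _ (h j)
  · apply dvd_of_map_dvd_map (E := L)
    rw [map_bind₁, hF, map_formG, hNg, hNg, hNg,
      formG_sq ⟨r, rfl⟩, hH]
    exact dvd_mul_right _ _
  · by_contra! h
    refine hGP2 0 (dvd_of_forall_dvd_sum_C hNN (w := fun i => formP r (linForm N) i ^ 2)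
      (fun j => ?_) 0)
    rw [← hgf]
    exact map_dvd _ (h j)
  · intro i j
    apply dvd_of_map_dvd_map (E := L)
    simp only [map_sub, map_mul, hgf, map_X]
    rw [hXN i, hXN j]
    refine dvd_cross_sum_C N' (fun a b => ?_) i j
    rw [hF', ← linSubst_formP, ← linSubst_formP, ← linSubst_X, ← linSubst_X, ← map_pow, ← map_pow,
      ← map_mul, ← map_mul, ← map_sub]
    exact map_dvd _ (formG_dvd_cross hr h2 a b)
  · by_contra! h
    refine hUP 0 (dvd_of_forall_dvd_sum_C hMM (w := formP r (fun j => linForm M j ^ 2))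
      (fun j => ?_) 0)
    rw [← hfg]
    exact map_dvd _ (h j)
  · intro i j
    apply dvd_of_map_dvd_map (E := L)
    simp only [map_sub, map_mul, hfg, map_X]
    rw [hXM i, hXM j]
    refine dvd_cross_sum_C M' (fun a b => ?_) i j
    rw [hH]
    exact formU_dvd_cross r (linForm M) a b

end PlaneModel

/-! ### Irreducibility and singular points over the algebraic closure -/

section Closure

variable {k L Ω : Type*} [Field k] [Field L] [Algebra k L] [Field Ω] [Algebra k Ω]
  {s : ℕ} {F H : MvPolynomial (Fin 3) k} {M M' N N' : Matrix (Fin 3) (Fin 3) L}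

theorem map_linForm (ι : L →+* Ω) (N : Matrix (Fin 3) (Fin 3) L) (i : Fin 3) :
    map ι (linForm N i) = linForm (N.map ι) i := by
  simp [linForm]

theorem map_map_algHom (ι : L →ₐ[k] Ω) (F : MvPolynomial (Fin 3) k) :
    map (algebraMap k Ω) F = map (ι : L →+* Ω) (map (algebraMap k L) F) := by
  rw [map_map, AlgHom.comp_algebraMap]

theorem map_mul_map_eq_one (ι : L →+* Ω) (h : N * N' = 1) : N.map ι * N'.map ι = 1 := by
  rw [← Matrix.map_mul, h, Matrix.map_one _ (map_zero ι) (map_one ι)]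

theorem irreducible_map_of_formG (ι : L →ₐ[k] Ω) (hs : Odd s) (hs2 : 2 ≤ s) (h2 : (2 : Ω) ≠ 0)
    (hNN : N * N' = 1)
    (hF : map (algebraMap k L) F = formG s (linForm N 0) (linForm N 1) (linForm N 2)) :
    Irreducible (map (algebraMap k Ω) F) := by
  rw [map_map_algHom ι, hF, map_formG, map_linForm, map_linForm, map_linForm, ← linSubst_formG]
  exact irreducible_linSubst (map_mul_map_eq_one _ hNN) (irreducible_formG hs hs2 h2)

theorem irreducible_map_of_formU (ι : L →ₐ[k] Ω) (hs2 : 2 ≤ s) (hMM : M * M' = 1)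
    (hH : map (algebraMap k L) H = formU s (linForm M 0) (linForm M 1) (linForm M 2)) :
    Irreducible (map (algebraMap k Ω) H) := by
  rw [map_map_algHom ι, hH, map_formU, map_linForm, map_linForm, map_linForm, ← linSubst_formU]
  exact irreducible_linSubst (map_mul_map_eq_one _ hMM) (irreducible_formU hs2)

theorem formG_eq (R : Type*) [CommRing R] (s : ℕ) (x₀ x₁ x₂ : R) : formG s x₀ x₁ x₂ =
    (x₁ * x₂ ^ s) * (x₁ * x₂ ^ s - x₀ * x₁ ^ s - x₀ ^ s * x₂)
      + (x₀ * x₁ ^ s) * (x₀ * x₁ ^ s - x₁ * x₂ ^ s - x₀ ^ s * x₂)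
      + (x₀ ^ s * x₂) * (x₀ ^ s * x₂ - x₁ * x₂ ^ s - x₀ * x₁ ^ s) := by
  simp only [formG]
  ring

/-- The vertices of the frame are singular points: `formG` is a quadratic form in three terms that
all vanish there. -/
theorem isSingularCurve_of_formG [Algebra.IsAlgebraic k L] (hs : s ≠ 0) (hNN : N * N' = 1)
    (hF : map (algebraMap k L) F = formG s (linForm N 0) (linForm N 1) (linForm N 2)) :
    IsSingularCurve F := by
  let ι : L →ₐ[k] AlgebraicClosure k := IsAlgClosed.lift
  set N₁ := N.map (ι : L →+* AlgebraicClosure k) with hN₁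
  set N₂ := N'.map (ι : L →+* AlgebraicClosure k) with hN₂
  have h := map_mul_map_eq_one (ι : L →+* AlgebraicClosure k) hNN
  rw [← hN₁, ← hN₂] at h
  have hl : ∀ i, eval (fun j => N₂ j 0) (linForm N₁ i) = if i = 0 then 1 else 0 := by
    intro i
    rw [← Matrix.one_apply, ← h, Matrix.mul_apply]
    simp [linForm]
  have hFΩ : map (algebraMap k (AlgebraicClosure k)) F =
      formG s (linForm N₁ 0) (linForm N₁ 1) (linForm N₁ 2) := by
    rw [map_map_algHom ι, hF, map_formG, map_linForm, map_linForm, map_linForm]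
  have ha : ∀ f : MvPolynomial (Fin 3) k, aeval (fun j => N₂ j 0) f =
      eval (fun j => N₂ j 0) (map (algebraMap k (AlgebraicClosure k)) f) := by
    intro f
    rw [eval_map, aeval_def]
  refine ⟨fun j => N₂ j 0, ?_, ?_, fun i => ?_⟩
  · intro h0
    have := hl 0
    rw [h0] at this
    simp [linForm] at this
  · rw [ha, hFΩ, map_formG, hl, hl, hl]
    simp [formG, hs]
  · rw [ha, ← pderiv_map, hFΩ, formG_eq]
    simp only [map_add, Derivation.leibniz, smul_eq_mul, map_mul, map_sub, map_pow, hl]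
    simp [hs]

end Closure

/-! ### Powers in finite fields -/

section FiniteField

/-- In the cyclic group of units of a finite field with `d e + 1` elements, the solutions of
`x ^ e = 1` are the `d`-th powers. -/
theorem exists_pow_eq_of_pow_eq_one {F : Type*} [Field F] [Finite F] {d e : ℕ}
    (h : d * e + 1 = Nat.card F) {x : F} (hx : x ^ e = 1) (he : e ≠ 0) :
    ∃ y : F, y ≠ 0 ∧ y ^ d = x := by
  have hx0 : x ≠ 0 := by
    rintro rfl
    simp [he] at hx
  obtain ⟨g, hg⟩ := IsCyclic.exists_ofOrder_eq_natCard (α := Fˣ)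
  have hcard : Nat.card Fˣ = d * e := by
    have := Nat.card_units F
    lia
  obtain ⟨n, hn⟩ : ∃ n : ℕ, g ^ n = Units.mk0 x hx0 := by
    have h1 : Units.mk0 x hx0 ∈ Subgroup.zpowers g := by
      rw [Subgroup.eq_top_of_card_eq (Subgroup.zpowers g) (by rw [Nat.card_zpowers, hg])]
      trivial
    exact (mem_powers_iff_mem_zpowers.2 h1)
  have h2 : d * e ∣ n * e := by
    rw [← hcard, ← hg, orderOf_dvd_iff_pow_eq_one, pow_mul, hn]
    ext
    simpa using hx
  obtain ⟨m, rfl⟩ := Nat.dvd_of_mul_dvd_mul_right (Nat.pos_of_ne_zero he) h2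
  refine ⟨((g ^ m : Fˣ) : F), Units.ne_zero _, ?_⟩
  rw [← Units.val_pow_eq_pow_val, ← pow_mul, mul_comm m, hn, Units.val_mk0]

variable {k : Type*} [Field k] [Finite k] {s : ℕ}

theorem exists_eq_prime_pow (hk : Nat.card k = s ^ 2) :
    ∃ p j : ℕ, p.Prime ∧ CharP k p ∧ s = p ^ j := by
  have := Fintype.ofFinite k
  obtain ⟨p, hp⟩ := CharP.exists k
  obtain ⟨n, hpp, hn⟩ := FiniteField.card k p
  rw [← Nat.card_eq_fintype_card, hk] at hn
  obtain ⟨j, -, hj⟩ := (Nat.dvd_prime_pow hpp).1 (hn ▸ dvd_pow_self s two_ne_zero)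
  exact ⟨p, j, hpp, hp, hj⟩

theorem three_le_of_card (hs : Odd s) (hk : Nat.card k = s ^ 2) : 3 ≤ s := by
  have h1 : 1 < s ^ 2 := hk ▸ Finite.one_lt_card
  have h2 : s ≠ 1 := by
    rintro rfl
    simp at h1
  obtain ⟨r, rfl⟩ := hs
  lia

theorem two_ne_zero_of_card (hs : Odd s) (hk : Nat.card k = s ^ 2) : (2 : k) ≠ 0 := by
  have := Fintype.ofFinite k
  apply Ring.two_ne_zero
  intro h
  have h1 := FiniteField.even_card_of_char_two h
  rw [← Nat.card_eq_fintype_card, hk] at h1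
  have h2 : Odd (s ^ 2) := hs.pow
  rw [Nat.odd_iff] at h2
  lia

/-- The endomorphism `x ↦ x ^ s` of a `k`-algebra, where `s ^ 2` is the cardinality of `k`. -/
noncomputable def powHom (R : Type*) [CommRing R] [Nontrivial R] [Algebra k R]
    (hk : Nat.card k = s ^ 2) : R →+* R where
  toFun x := x ^ s
  map_one' := one_pow s
  map_mul' x y := mul_pow x y s
  map_zero' := zero_pow (by
    rintro rfl
    exact Nat.card_pos.ne' (hk.trans (zero_pow two_ne_zero)))
  map_add' x y := by
    obtain ⟨p, j, hp, hc, rfl⟩ := exists_eq_prime_pow hk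
    have := Fact.mk hp
    have : CharP R p := charP_of_injective_algebraMap (algebraMap k R).injective p
    exact add_pow_char_pow x y p j

theorem powHom_apply (R : Type*) [CommRing R] [Nontrivial R] [Algebra k R]
    (hk : Nat.card k = s ^ 2) (x : R) : powHom R hk x = x ^ s := rfl

theorem pow_sq_eq (hk : Nat.card k = s ^ 2) (c : k) : c ^ s ^ 2 = c := by
  have := Fintype.ofFinite k
  rw [← hk, Nat.card_eq_fintype_card, FiniteField.pow_card]

theorem pow_cube_eq (hk : Nat.card k = s ^ 2) (c : k) : c ^ s ^ 3 = c ^ s := by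
  rw [pow_succ s 2, pow_mul, pow_sq_eq hk]

/-- An element of the subfield with `s` elements is a norm from `k`. -/
theorem exists_pow_add_one_eq (hs3 : 3 ≤ s) (hk : Nat.card k = s ^ 2) {d : k} (hd : d ^ s = d)
    (hd0 : d ≠ 0) : ∃ t : k, t ≠ 0 ∧ t ^ (s + 1) = d := by
  obtain ⟨m, rfl⟩ : ∃ m, s = m + 1 := ⟨s - 1, by lia⟩
  refine exists_pow_eq_of_pow_eq_one (e := m) ?_ ?_ (by lia)
  · rw [hk]
    ring
  · rw [pow_succ] at hd
    exact mul_right_cancel₀ hd0 (hd.trans (one_mul d).symm)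

end FiniteField

/-! ### The cubic extension and the conjugates of a basis -/

section Cubic

variable {k L : Type*} [Field k] [Finite k] [Field L] [Algebra k L] {s : ℕ}

omit [Finite k] in
theorem module_finite_of_finrank (hL : Module.finrank k L = 3) : Module.Finite k L :=
  Module.finite_of_finrank_pos (by lia)

theorem finite_of_finrank (hL : Module.finrank k L = 3) : Finite L :=
  have := module_finite_of_finrank hL
  Module.finite_of_finite k

omit [Finite k] in
theorem card_cubic (hk : Nat.card k = s ^ 2) (hL : Module.finrank k L = 3) :
    Nat.card L = s ^ 6 := by
  have := module_finite_of_finrank hL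
  rw [Module.natCard_eq_pow_finrank (K := k), hk, hL, ← pow_mul]

theorem pow_six_eq (hk : Nat.card k = s ^ 2) (hL : Module.finrank k L = 3) (x : L) :
    x ^ s ^ 6 = x := by
  have := finite_of_finrank hL
  have := Fintype.ofFinite L
  rw [← card_cubic hk hL, Nat.card_eq_fintype_card, FiniteField.pow_card]

theorem mem_range_of_pow_eq (hk : Nat.card k = s ^ 2) (hL : Module.finrank k L = 3) {x : L}
    (hx : x ^ s ^ 2 = x) : x ∈ (algebraMap k L).range := by
  have := finite_of_finrank hL
  have := module_finite_of_finrank hL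
  have := Fintype.ofFinite k
  have h1 : x ∈ (⊥ : IntermediateField k L) := by
    rw [IsGalois.mem_bot_iff_fixed]
    intro f
    obtain ⟨i, rfl⟩ := (FiniteField.bijective_frobeniusAlgEquivOfAlgebraic_pow k L).2 f
    rw [AlgEquiv.coe_pow]
    apply Function.iterate_fixed
    rw [FiniteField.coe_frobeniusAlgEquivOfAlgebraic, ← Nat.card_eq_fintype_card, hk]
    exact hx
  obtain ⟨c, rfl⟩ := IntermediateField.mem_bot.1 h1
  exact ⟨c, rfl⟩

theorem algebraMap_pow_sq (hk : Nat.card k = s ^ 2) (c : k) :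
    algebraMap k L c ^ s ^ 2 = algebraMap k L c := by
  rw [← map_pow, pow_sq_eq hk]

/-- The Frobenius automorphism of `L` over `k`. -/
noncomputable def frob (L : Type*) [Field L] [Algebra k L] (hk : Nat.card k = s ^ 2) : L →ₐ[k] L :=
  { (powHom (k := k) L hk).comp (powHom (k := k) L hk) with
    commutes' := fun c => by
      change (algebraMap k L c ^ s) ^ s = _
      rw [← pow_mul, ← pow_two, algebraMap_pow_sq hk] }

theorem frob_apply (hk : Nat.card k = s ^ 2) (x : L) : frob L hk x = x ^ s ^ 2 := by
  change (x ^ s) ^ s = _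
  rw [← pow_mul, pow_two]

theorem algebraMap_trace (hk : Nat.card k = s ^ 2) (hL : Module.finrank k L = 3) (x : L) :
    algebraMap k L (Algebra.trace k L x) = x + x ^ s ^ 2 + x ^ s ^ 4 := by
  have := finite_of_finrank hL
  rw [FiniteField.algebraMap_trace_eq_sum_pow, hL, hk]
  simp [Finset.sum_range_succ, ← pow_mul]

theorem exists_trace_mul_ne_zero (hL : Module.finrank k L = 3) {x : L} (hx : x ≠ 0) :
    ∃ y, Algebra.trace k L (x * y) ≠ 0 := by
  have := finite_of_finrank hL
  have := module_finite_of_finrank hL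
  by_contra! h
  exact hx ((traceForm_nondegenerate k L).1 x (by simpa [Algebra.traceForm_apply] using h))

/-- The matrix of the conjugates of the elements of a family. -/
def frame (s : ℕ) (f : Fin 3 → L) : Matrix (Fin 3) (Fin 3) L :=
  Matrix.of fun i j => f j ^ (s ^ 2) ^ (i : ℕ)

theorem frame_apply (f : Fin 3 → L) (i j : Fin 3) :
    frame s f i j = f j ^ (s ^ 2) ^ (i : ℕ) := rfl

theorem isCyclicFrame_frame (hk : Nat.card k = s ^ 2) (hL : Module.finrank k L = 3)
    (f : Fin 3 → L) : IsCyclicFrame (frob L hk) (frame s f) := by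
  intro i j
  simp only [frob_apply, frame_apply, ← pow_mul]
  fin_cases i
  · simp
  · simp [← pow_add]
  · simp only [Fin.reduceFinMk, Fin.isValue, Fin.reduceAdd, ← pow_add]
    norm_num
    exact pow_six_eq hk hL _

theorem fixed_mem_range (hk : Nat.card k = s ^ 2) (hL : Module.finrank k L = 3) (x : L)
    (hx : frob L hk x = x) : x ∈ (algebraMap k L).range := by
  rw [frob_apply] at hx
  exact mem_range_of_pow_eq hk hL hx

/-- The matrix of conjugates of a basis is invertible; its inverse is the transposed matrix of the
dual basis for the trace form. -/
theorem frame_mul_eq_one (hk : Nat.card k = s ^ 2) (hL : Module.finrank k L = 3)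
    (e : Module.Basis (Fin 3) k L) : ∃ M' : Matrix (Fin 3) (Fin 3) L, frame s e * M' = 1 := by
  have := finite_of_finrank hL
  have := module_finite_of_finrank hL
  refine ⟨(frame s e.traceDual).transpose, mul_eq_one_comm.1 ?_⟩
  ext i j
  rw [Matrix.mul_apply, Fin.sum_univ_three]
  simp only [Matrix.transpose_apply, frame_apply, ← mul_pow]
  have h := algebraMap_trace hk hL (e.traceDual i * e j)
  rw [Module.Basis.trace_traceDual_mul] at h
  simp only [Fin.isValue, Fin.coe_ofNat_eq_mod, Nat.zero_mod, pow_zero, pow_one, ← pow_mul,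
    Nat.one_mod, Nat.reduceMod, Nat.reduceMul]
  rw [← h, Matrix.one_apply]
  simp [eq_comm, apply_ite (algebraMap k L)]

theorem linearIndependent_of_frame (hk : Nat.card k = s ^ 2) {f : Fin 3 → L}
    {N' : Matrix (Fin 3) (Fin 3) L} (h : N' * frame s f = 1) : LinearIndependent k f := by
  rw [Fintype.linearIndependent_iff]
  intro c hc
  have h1 : ∀ i, ∑ j, frame s f i j * algebraMap k L (c j) = 0 := by
    intro i
    have h2 : ∀ n : ℕ, ∑ j, f j ^ (s ^ 2) ^ n * algebraMap k L (c j) = 0 := by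
      intro n
      induction n with
      | zero =>
        simpa [Algebra.smul_def, mul_comm] using hc
      | succ n ih =>
        have h3 := congrArg (frob L hk) ih
        simp only [map_sum, map_mul, AlgHom.commutes, map_zero, frob_apply, ← pow_mul] at h3
        rw [← h3]
        simp only [← pow_mul, ← pow_add, mul_add, mul_one]
    exact h2 i
  intro j
  have h2 : (fun j => algebraMap k L (c j)) = 0 := by
    rw [← Matrix.one_mulVec fun j => algebraMap k L (c j), ← h, ← Matrix.mulVec_mulVec]
    have : (frame s f).mulVec (fun j => algebraMap k L (c j)) = 0 := funext h1
    rw [this, Matrix.mulVec_zero]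
  exact (algebraMap k L).injective (by simpa using congrFun h2 j)

omit [Finite k] in
theorem basis_of_linearIndependent (hL : Module.finrank k L = 3) {f : Fin 3 → L}
    (h : LinearIndependent k f) : ∃ e : Module.Basis (Fin 3) k L, ⇑e = f :=
  have := module_finite_of_finrank hL
  ⟨basisOfLinearIndependentOfCardEqFinrank h (by simp [hL]), by simp⟩

end Cubic

/-! ### The Hermitian form on the cubic extension -/

section HermitianForm

variable {k L : Type*} [Field k] [Finite k] [Field L] [Algebra k L] {s : ℕ}

/-- The Hermitian form `Tr(x y ^ (s ^ 3))` of `L` over `k`; here `y ↦ y ^ (s ^ 3)` is the involution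
of `L`. -/
noncomputable def hermForm (k : Type*) {L : Type*} [Field k] [Field L] [Algebra k L] (s : ℕ)
    (x y : L) : k :=
  Algebra.trace k L (x * y ^ s ^ 3)

omit [Finite k] in
theorem hermForm_add_left (x y z : L) :
    hermForm k s (x + y) z = hermForm k s x z + hermForm k s y z := by
  simp [hermForm, add_mul]

omit [Finite k] in
theorem hermForm_smul_left (c : k) (x y : L) :
    hermForm k s (c • x) y = c * hermForm k s x y := by
  simp [hermForm]

theorem trace_pow_cube (hk : Nat.card k = s ^ 2) (hL : Module.finrank k L = 3) (x : L) :
    Algebra.trace k L (x ^ s ^ 3) = Algebra.trace k L x ^ s := by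
  apply (algebraMap k L).injective
  rw [RingHom.map_pow, algebraMap_trace hk hL, algebraMap_trace hk hL, ← powHom_apply L hk, map_add,
    map_add]
  simp only [powHom_apply, ← pow_mul, ← pow_add, ← pow_succ]
  have h : x ^ s ^ (3 + 4) = x ^ s := by
    rw [show 3 + 4 = 6 + 1 from rfl, pow_succ, pow_mul, pow_six_eq hk hL]
  rw [h]
  ring

theorem pow_cube_pow_cube (hk : Nat.card k = s ^ 2) (hL : Module.finrank k L = 3) (x : L) :
    (x ^ s ^ 3) ^ s ^ 3 = x := by
  rw [← pow_mul, ← pow_add, pow_six_eq hk hL]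

theorem hermForm_symm (hk : Nat.card k = s ^ 2) (hL : Module.finrank k L = 3) (x y : L) :
    hermForm k s x y ^ s = hermForm k s y x := by
  rw [hermForm, ← trace_pow_cube hk hL, mul_pow, pow_cube_pow_cube hk hL, mul_comm, hermForm]

theorem hermForm_add_right (hk : Nat.card k = s ^ 2) (hL : Module.finrank k L = 3) (x y z : L) :
    hermForm k s x (y + z) = hermForm k s x y + hermForm k s x z := by
  rw [← hermForm_symm hk hL, hermForm_add_left, ← powHom_apply k hk, map_add]
  simp only [powHom_apply, hermForm_symm hk hL]

theorem hermForm_smul_right (hk : Nat.card k = s ^ 2) (hL : Module.finrank k L = 3) (c : k)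
    (x y : L) : hermForm k s x (c • y) = c ^ s * hermForm k s x y := by
  rw [← hermForm_symm hk hL, hermForm_smul_left, mul_pow, hermForm_symm hk hL]

/-- The functional `x ↦ Tr(x y)`. -/
noncomputable def traceMul (k : Type*) {L : Type*} [Field k] [Field L] [Algebra k L] (y : L) :
    L →ₗ[k] k :=
  Algebra.trace k L ∘ₗ LinearMap.mulRight k y

omit [Finite k] in
theorem traceMul_apply (x y : L) : traceMul k y x = Algebra.trace k L (x * y) := rfl

omit [Finite k] in
theorem exists_orthogonal (hL : Module.finrank k L = 3) (y z : L) :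
    ∃ x : L, x ≠ 0 ∧ hermForm k s x y = 0 ∧ hermForm k s x z = 0 := by
  have := module_finite_of_finrank hL
  have h := LinearMap.ker_ne_bot_of_finrank_lt
    (f := (traceMul k (y ^ s ^ 3)).prod (traceMul k (z ^ s ^ 3))) (by
      rw [hL, Module.finrank_prod, Module.finrank_self]
      lia)
  obtain ⟨x, hx, hx0⟩ := Submodule.exists_mem_ne_zero_of_ne_bot h
  have hx' : (traceMul k (y ^ s ^ 3) x, traceMul k (z ^ s ^ 3) x) = (0, 0) := hx
  rw [Prod.mk.injEq] at hx'
  exact ⟨x, hx0, hx'.1, hx'.2⟩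

/-- The Hermitian form has an isotropic vector, found in the span of two orthogonal vectors. -/
theorem exists_isotropic (hs3 : 3 ≤ s) (hs : Odd s) (hk : Nat.card k = s ^ 2)
    (hL : Module.finrank k L = 3) : ∃ v : L, v ≠ 0 ∧ hermForm k s v v = 0 := by
  by_cases h1 : hermForm k s (1 : L) 1 = 0
  · exact ⟨1, one_ne_zero, h1⟩
  obtain ⟨y, hy0, hy, -⟩ := exists_orthogonal (s := s) hL (1 : L) 1
  by_cases h2 : hermForm k s y y = 0
  · exact ⟨y, hy0, h2⟩
  have hy' : hermForm k s 1 y = 0 := by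
    rw [← hermForm_symm hk hL, hy, zero_pow (by lia)]
  obtain ⟨t, ht0, ht⟩ := exists_pow_add_one_eq hs3 hk
    (d := -(hermForm k s (1 : L) 1 / hermForm k s y y)) (by
      rw [hs.neg_pow, div_pow, hermForm_symm hk hL, hermForm_symm hk hL])
    (neg_ne_zero.2 (div_ne_zero h1 h2))
  refine ⟨1 + t • y, fun h => h1 ?_, ?_⟩
  · have h3 : (1 : L) = (-t) • y := by
      rw [neg_smul]
      exact eq_neg_of_add_eq_zero_left h
    calc hermForm k s (1 : L) 1 = hermForm k s ((-t) • y) 1 := by rw [← h3]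
      _ = 0 := by rw [hermForm_smul_left, hy, mul_zero]
  · rw [hermForm_add_left, hermForm_add_right hk hL, hermForm_add_right hk hL, hermForm_smul_left,
      hermForm_smul_left, hermForm_smul_right hk hL, hermForm_smul_right hk hL, hy, hy']
    rw [pow_succ] at ht
    have h4 : t * (t ^ s * hermForm k s y y) = (t ^ s * t) * hermForm k s y y := by ring
    rw [h4, ht]
    field_simp
    ring

/-- The Gram matrix of the standard Hermitian form `Y ^ s Z + Y Z ^ s - X ^ (s + 1)`. -/
def hermGram (k : Type*) [Field k] : Matrix (Fin 3) (Fin 3) k :=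
  !![-1, 0, 0; 0, 0, 1; 0, 1, 0]

/-- The Hermitian form on `L` has the standard Gram matrix in a suitable basis: a hyperbolic pair
and a normalized vector orthogonal to it. -/
theorem exists_hermitian_basis (hs3 : 3 ≤ s) (hs : Odd s) (hk : Nat.card k = s ^ 2)
    (hL : Module.finrank k L = 3) :
    ∃ e : Module.Basis (Fin 3) k L, ∀ i j, hermForm k s (e i) (e j) = hermGram k i j := by
  have hs0 : s ≠ 0 := by lia
  have h2 := two_ne_zero_of_card hs hk
  obtain ⟨v, hv0, hv⟩ := exists_isotropic (L := L) hs3 hs hk hL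
  -- a second isotropic vector, paired with the first to `1`
  obtain ⟨w, hvw, hww⟩ : ∃ w : L, hermForm k s v w = 1 ∧ hermForm k s w w = 0 := by
    obtain ⟨y, hy⟩ := exists_trace_mul_ne_zero hL hv0
    obtain ⟨w₀, hw₀⟩ : ∃ w₀ : L, hermForm k s v w₀ = 1 := by
      refine ⟨((Algebra.trace k L (v * y))⁻¹ • y) ^ s ^ 3, ?_⟩
      rw [hermForm, pow_cube_pow_cube hk hL, mul_smul_comm, map_smul, smul_eq_mul,
        inv_mul_cancel₀ hy]
    have hw₀' : hermForm k s w₀ v = 1 := by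
      rw [← hermForm_symm hk hL, hw₀, one_pow]
    set d := hermForm k s w₀ w₀ with hd
    have hds : d ^ s = d := hermForm_symm hk hL w₀ w₀
    have h2s : (2 : k) ^ s = 2 := by
      rw [← powHom_apply k hk, map_ofNat]
    refine ⟨w₀ + (-d / 2) • v, ?_, ?_⟩
    · rw [hermForm_add_right hk hL, hermForm_smul_right hk hL, hw₀, hv, mul_zero, add_zero]
    · rw [hermForm_add_left, hermForm_add_right hk hL, hermForm_add_right hk hL,
        hermForm_smul_left, hermForm_smul_left, hermForm_smul_right hk hL,
        hermForm_smul_right hk hL, hv, hw₀, hw₀', div_pow, hs.neg_pow, hds, h2s, ← hd]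
      field_simp
      ring
  have hwv : hermForm k s w v = 1 := by
    rw [← hermForm_symm hk hL, hvw, one_pow]
  obtain ⟨u, hu0, huv, huw⟩ := exists_orthogonal (s := s) hL v w
  have hvu : hermForm k s v u = 0 := by
    rw [← hermForm_symm hk hL, huv, zero_pow hs0]
  have hwu : hermForm k s w u = 0 := by
    rw [← hermForm_symm hk hL, huw, zero_pow hs0]
  have hsum : ∀ (c : Fin 3 → k) (y : L), hermForm k s (∑ i, c i • ![u, v, w] i) y =
      c 0 * hermForm k s u y + c 1 * hermForm k s v y + c 2 * hermForm k s w y := by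
    intro c y
    rw [Fin.sum_univ_three, hermForm_add_left, hermForm_add_left]
    simp [hermForm_smul_left]
  have hind : LinearIndependent k ![u, v, w] := by
    rw [Fintype.linearIndependent_iff]
    intro c hc
    have hz : ∀ y : L, hermForm k s 0 y = 0 := fun y => by simp [hermForm]
    have e1 := hsum c v
    have e2 := hsum c w
    rw [hc, hz, huv, hv, hwv] at e1
    rw [hc, hz, huw, hvw, hww] at e2
    have c2 : c 2 = 0 := by linear_combination -e1
    have c1 : c 1 = 0 := by linear_combination -e2
    have c0 : c 0 = 0 := by
      rw [Fin.sum_univ_three] at hc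
      simpa [c1, c2, hu0] using hc
    intro i
    fin_cases i
    · exact c0
    · exact c1
    · exact c2
  have huu : hermForm k s u u ≠ 0 := by
    intro h
    obtain ⟨e, he⟩ := basis_of_linearIndependent hL hind
    obtain ⟨y, hy⟩ := exists_trace_mul_ne_zero hL (pow_ne_zero (s ^ 3) hu0)
    apply hy
    have h3 := hsum (e.repr y) u
    rw [← he, e.sum_repr, h, hvu, hwu] at h3
    rw [mul_comm]
    simpa [hermForm] using h3
  obtain ⟨t, ht0, ht⟩ := exists_pow_add_one_eq hs3 hk (d := -(hermForm k s u u)⁻¹) (by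
    rw [hs.neg_pow, inv_pow, hermForm_symm hk hL]) (neg_ne_zero.2 (inv_ne_zero huu))
  have hind' : LinearIndependent k ![t • u, v, w] := by
    have := hind.units_smul ![Units.mk0 t ht0, 1, 1]
    convert this using 1
    ext i
    fin_cases i <;> simp [Units.smul_def]
  obtain ⟨e, he⟩ := basis_of_linearIndependent hL hind'
  refine ⟨e, fun i j => ?_⟩
  rw [he]
  have htu : hermForm k s (t • u) (t • u) = -1 := by
    rw [hermForm_smul_left, hermForm_smul_right hk hL, ← mul_assoc, ← pow_succ', ht]
    field_simp
  fin_cases i <;> fin_cases j <;>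
    simp [hermGram, htu, hermForm_smul_left, hermForm_smul_right hk hL, huv, huw, hvu, hwu, hv, hvw,
      hwv, hww]

theorem linForm_frame_pow (hk : Nat.card k = s ^ 2) (f : Fin 3 → L) (i : Fin 3) :
    linForm (frame s f) i ^ s = ∑ j, C (f j ^ (s * (s ^ 2) ^ (i : ℕ))) * X j ^ s := by
  rw [← powHom_apply (MvPolynomial (Fin 3) L) hk, linForm, map_sum]
  simp only [powHom_apply, mul_pow, frame_apply, ← C_pow, ← pow_mul]
  simp only [mul_comm s]

/-- The Hermitian form is given by `formU` in the frame of conjugates. -/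
theorem formU_frame (hk : Nat.card k = s ^ 2) (hL : Module.finrank k L = 3) (f : Fin 3 → L) :
    formU s (linForm (frame s f) 0) (linForm (frame s f) 1) (linForm (frame s f) 2) =
      ∑ i, ∑ j, C (algebraMap k L (hermForm k s (f i) (f j))) * (X i * X j ^ s) := by
  have h0 : ∀ i, (f i : L) ^ s ^ 7 = f i ^ s := by
    intro i
    rw [pow_succ s 6, pow_mul, pow_six_eq hk hL]
  have h1 : formU s (linForm (frame s f) 0) (linForm (frame s f) 1) (linForm (frame s f) 2) =
    linForm (frame s f) 0 * linForm (frame s f) 1 ^ s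
      + linForm (frame s f) 1 * linForm (frame s f) 2 ^ s
      + linForm (frame s f) 2 * linForm (frame s f) 0 ^ s := by
    simp only [formU]
    ring
  rw [h1]
  simp only [linForm_frame_pow hk]
  simp only [linForm, Finset.sum_mul_sum, ← Finset.sum_add_distrib]
  refine Finset.sum_congr rfl fun i _ => Finset.sum_congr rfl fun j _ => ?_
  rw [hermForm, algebraMap_trace hk hL]
  simp only [frame_apply, Fin.isValue, Fin.coe_ofNat_eq_mod, Nat.zero_mod, Nat.one_mod,
    Nat.reduceMod, mul_pow, ← pow_mul, ← pow_add, map_add, map_mul, Nat.reduceAdd, h0, pow_zero,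
    pow_one, mul_one]
  ring_nf

/-- The Hermitian curve is the curve of `formU` in the frame of conjugates of a basis with the
standard Gram matrix. -/
theorem map_hermitian_eq (hk : Nat.card k = s ^ 2) (hL : Module.finrank k L = 3)
    {e : Module.Basis (Fin 3) k L} (he : ∀ i j, hermForm k s (e i) (e j) = hermGram k i j) :
    map (algebraMap k L) (hermitian k s) =
      formU s (linForm (frame s e) 0) (linForm (frame s e) 1) (linForm (frame s e) 2) := by
  rw [formU_frame hk hL]
  simp only [he, hermGram, Fin.sum_univ_three, hermitian]
  simp
  ring

theorem isHomogeneous_hermitian (k : Type*) [Field k] (s : ℕ) :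
    (hermitian k s).IsHomogeneous (s + 1) := by
  have h1 : ∀ i j : Fin 3, (X i ^ s * X j : MvPolynomial (Fin 3) k).IsHomogeneous (s + 1) :=
    fun i j => by simpa using ((isHomogeneous_X k i).pow s).mul (isHomogeneous_X k j)
  rw [hermitian, mul_comm (X 1), pow_succ]
  exact ((h1 1 2).add (h1 2 1)).sub (h1 0 0)

end HermitianForm

/-! ### Lines and the norm-one group -/

section CubicArithmetic

variable {k L : Type*} [Field k] [Field L] [Algebra k L] {s : ℕ}

/-- A cubic extension contains no quadratic irrationalities. -/
theorem mem_range_of_quadratic (hL : Module.finrank k L = 3) {t : L} {a b c : k} (ha : a ≠ 0)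
    (h : algebraMap k L a * t ^ 2 + algebraMap k L b * t + algebraMap k L c = 0) :
    t ∈ (algebraMap k L).range := by
  have := module_finite_of_finrank hL
  set p : Polynomial k := Polynomial.C a * Polynomial.X ^ 2 + Polynomial.C b * Polynomial.X
    + Polynomial.C c with hp
  have hdeg : p.natDegree = 2 := Polynomial.natDegree_quadratic ha
  have hp0 : p ≠ 0 := by
    intro h0
    rw [h0] at hdeg
    simp at hdeg
  have hroot : Polynomial.aeval t p = 0 := by
    simpa [hp] using h
  have h1 : (minpoly k t).natDegree ≤ 2 :=
    hdeg ▸ Polynomial.natDegree_le_of_dvd (minpoly.dvd k t hroot) hp0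
  have h2 : (minpoly k t).natDegree ∣ 3 := hL ▸ minpoly.degree_dvd (Algebra.IsIntegral.isIntegral t)
  rw [← minpoly.natDegree_eq_one_iff]
  rcases (Nat.dvd_prime Nat.prime_three).1 h2 with h3 | h3
  · exact h3
  · lia

theorem ne_zero_of_pow_eq_one {z : L} (hz : z ^ (s ^ 3 + 1) = 1) : z ≠ 0 := by
  rintro rfl
  simp at hz

theorem pow_cube_eq_inv {z : L} (hz : z ^ (s ^ 3 + 1) = 1) : z ^ s ^ 3 = z⁻¹ := by
  rw [pow_succ] at hz
  exact eq_inv_of_mul_eq_one_left hz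

/-- The proportionality relation defining points of the projective plane of `L` over `k`. -/
def Proportional (k : Type*) {L : Type*} [Field k] [Field L] [Algebra k L] (x y : L) : Prop :=
  ∃ c : k, x = c • y

theorem proportional_of_add_eq_zero {x y : L} {a b : k} (ha : a ≠ 0)
    (h : a • x + b • y = 0) : Proportional k x y := by
  refine ⟨-(a⁻¹ * b), ?_⟩
  have h1 : a⁻¹ • (a • x + b • y) = 0 := by rw [h, smul_zero]
  rw [smul_add, smul_smul, inv_mul_cancel₀ ha, one_smul, smul_smul] at h1
  rw [neg_smul]
  exact eq_neg_of_add_eq_zero_left h1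

theorem Proportional.symm {x y : L} (hx : x ≠ 0) (h : Proportional k x y) :
    Proportional k y x := by
  obtain ⟨c, rfl⟩ := h
  have hc : c ≠ 0 := by
    rintro rfl
    simp at hx
  exact ⟨c⁻¹, by rw [smul_smul, inv_mul_cancel₀ hc, one_smul]⟩

theorem mem_range_of_proportional_one {x : L} (h : Proportional k x 1) :
    x ∈ (algebraMap k L).range := by
  obtain ⟨c, rfl⟩ := h
  exact ⟨c, by rw [Algebra.algebraMap_eq_smul_one]⟩

variable [Finite k]

/-- Three elements `z` with `z ^ (s ^ 3 + 1) = 1` that are linearly dependent over `k` represent at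
most two points. If `z₁ = b z₂ + c z₃` with `b c ≠ 0`, then the involution, which inverts the `zᵢ`,
gives a second relation, and eliminating `z₁` leaves a quadratic equation for `z₃ / z₂`. -/
theorem proportional_of_dependent (hk : Nat.card k = s ^ 2) (hL : Module.finrank k L = 3)
    {z₁ z₂ z₃ : L} (h₁ : z₁ ^ (s ^ 3 + 1) = 1) (h₂ : z₂ ^ (s ^ 3 + 1) = 1)
    (h₃ : z₃ ^ (s ^ 3 + 1) = 1) {a b c : k} (h : a • z₁ + b • z₂ + c • z₃ = 0)
    (habc : a ≠ 0 ∨ b ≠ 0 ∨ c ≠ 0) :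
    Proportional k z₁ z₂ ∨ Proportional k z₁ z₃ ∨ Proportional k z₂ z₃ := by
  have n₁ := ne_zero_of_pow_eq_one h₁
  have n₂ := ne_zero_of_pow_eq_one h₂
  have n₃ := ne_zero_of_pow_eq_one h₃
  by_cases ha : a = 0
  · right; right
    rw [ha, zero_smul, zero_add] at h
    by_cases hb : b = 0
    · rw [hb, zero_smul, zero_add] at h
      rcases smul_eq_zero.1 h with h | h
      · simp [ha, hb, h] at habc
      · exact absurd h n₃
    · exact proportional_of_add_eq_zero hb h
  by_cases hb : b = 0
  · right; left
    rw [hb, zero_smul, add_zero] at h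
    exact proportional_of_add_eq_zero ha h
  by_cases hc : c = 0
  · left
    rw [hc, zero_smul, add_zero] at h
    exact proportional_of_add_eq_zero ha h
  right; right
  obtain ⟨β, hβ⟩ : ∃ β, β = -(a⁻¹ * b) := ⟨_, rfl⟩
  obtain ⟨γ, hγ⟩ : ∃ γ, γ = -(a⁻¹ * c) := ⟨_, rfl⟩
  have hβ0 : β ≠ 0 := by simp [hβ, ha, hb]
  have hγ0 : γ ≠ 0 := by simp [hγ, ha, hc]
  have hz : z₁ = algebraMap k L β * z₂ + algebraMap k L γ * z₃ := by
    have h4 : algebraMap k L a ≠ 0 := by simpa using ha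
    simp only [Algebra.smul_def] at h
    simp only [hβ, hγ, map_neg, map_mul, map_inv₀]
    field_simp
    linear_combination h
  have hz' : z₁⁻¹ = algebraMap k L (β ^ s) * z₂⁻¹ + algebraMap k L (γ ^ s) * z₃⁻¹ := by
    have h4 : ∀ x y : L, (x + y) ^ s ^ 3 = x ^ s ^ 3 + y ^ s ^ 3 := by
      intro x y
      simp only [pow_succ s, pow_zero, one_mul, pow_mul, ← powHom_apply L hk, map_add]
    rw [← pow_cube_eq_inv h₁, ← pow_cube_eq_inv h₂, ← pow_cube_eq_inv h₃, hz, h4, mul_pow, mul_pow,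
      ← map_pow, ← map_pow, pow_cube_eq hk, pow_cube_eq hk]
  have key : z₂ / z₃ ∈ (algebraMap k L).range := by
    refine mem_range_of_quadratic hL (a := β * γ ^ s) (b := β ^ (s + 1) + γ ^ (s + 1) - 1)
      (c := γ * β ^ s) (mul_ne_zero hβ0 (pow_ne_zero _ hγ0)) ?_
    have h5 : z₁ * z₁⁻¹ = 1 := mul_inv_cancel₀ n₁
    rw [hz', hz] at h5
    simp only [map_mul, map_pow, map_sub, map_add, map_one] at h5 ⊢
    field_simp at h5 ⊢
    linear_combination h5
  obtain ⟨d, hd⟩ := key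
  refine ⟨d, ?_⟩
  rw [Algebra.smul_def, hd, div_mul_cancel₀ _ n₃]

/-- The points of the norm-one group `z ^ (s ^ 3 + 1) = 1` on a line are at most two. -/
theorem proportional_of_functional (hk : Nat.card k = s ^ 2) (hL : Module.finrank k L = 3)
    {z₁ z₂ z₃ : L} (h₁ : z₁ ^ (s ^ 3 + 1) = 1) (h₂ : z₂ ^ (s ^ 3 + 1) = 1)
    (h₃ : z₃ ^ (s ^ 3 + 1) = 1) {φ : L →ₗ[k] k} (hφ : φ ≠ 0) (e₁ : φ z₁ = 0) (e₂ : φ z₂ = 0)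
    (e₃ : φ z₃ = 0) :
    Proportional k z₁ z₂ ∨ Proportional k z₁ z₃ ∨ Proportional k z₂ z₃ := by
  have h : ¬ LinearIndependent k ![z₁, z₂, z₃] := by
    intro h
    obtain ⟨e, he⟩ := basis_of_linearIndependent hL h
    refine hφ (e.ext fun i => ?_)
    rw [he]
    fin_cases i
    · exact e₁
    · exact e₂
    · exact e₃
  rw [Fintype.not_linearIndependent_iff] at h
  obtain ⟨g, hg, i, hi⟩ := h
  rw [Fin.sum_univ_three] at hg
  refine proportional_of_dependent hk hL h₁ h₂ h₃ hg ?_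
  fin_cases i
  · exact Or.inl hi
  · exact Or.inr (Or.inl hi)
  · exact Or.inr (Or.inr hi)

end CubicArithmetic

/-! ### The polynomial `x ^ (s + 1) + x + 1` -/

section Roots

variable {k : Type*} [Field k] [Finite k] {s : ℕ}

/-- The roots of `x ^ (s + 1) + x + 1` are moved by the Frobenius map `x ↦ x ^ s` along a
fractional linear transformation of order three. -/
theorem pow_sq_mul_of_root {R : Type*} [CommRing R] [Nontrivial R] [Algebra k R]
    (hk : Nat.card k = s ^ 2) {x : R} (hx : x ^ (s + 1) + x + 1 = 0) :
    x ^ s ^ 2 * (x + 1) = -1 ∧ x ^ s ^ 3 = x := by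
  rw [pow_succ] at hx
  have h1 : x ^ s ^ 2 * x ^ s + x ^ s + 1 = 0 := by
    have := congrArg (powHom R hk) hx
    simp only [map_add, map_mul, map_one, map_zero, powHom_apply, ← pow_mul, ← pow_two] at this
    exact this
  have h2 : x ^ s ^ 2 * (x + 1) = -1 := by
    linear_combination x ^ s ^ 2 * hx - x * h1 + hx
  have h3 : x ^ s ^ 3 * (x ^ s + 1) = -1 := by
    have := congrArg (powHom R hk) h2
    simp only [map_add, map_mul, map_one, map_neg, powHom_apply, ← pow_mul, ← pow_succ] at this
    exact this
  refine ⟨h2, ?_⟩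
  linear_combination (-x) * h3 + x ^ s ^ 3 * hx

variable {L : Type*} [Field L] [Algebra k L]

open Polynomial in
/-- The polynomial `x ^ (s + 1) + x + 1` has `s + 1` distinct roots in `L`. -/
theorem exists_finset_roots (hs3 : 3 ≤ s) (hk : Nat.card k = s ^ 2)
    (hL : Module.finrank k L = 3) :
    ∃ W : Finset L, (∀ x, x ∈ W ↔ x ^ (s + 1) + x + 1 = 0) ∧ W.card = s + 1 ∧
      ∏ x ∈ W, (Polynomial.X - Polynomial.C x) =
        (Polynomial.X ^ (s + 1) + Polynomial.X + 1 : Polynomial L) := by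
  classical
  have := finite_of_finrank hL
  have := Fintype.ofFinite L
  set f : L[X] := Polynomial.X ^ (s + 1) + Polynomial.X + 1 with hf
  have hcard : Fintype.card L = s ^ 6 := by
    rw [← Nat.card_eq_fintype_card, card_cubic hk hL]
  have h1card : 1 < s ^ 6 := Nat.one_lt_pow (by lia) (by lia)
  have hdeg : f.natDegree = s + 1 := by
    rw [hf]
    compute_degree!
    simp [show s ≠ 0 by lia]
  have hmonic : f.Monic := by
    rw [Polynomial.Monic, Polynomial.leadingCoeff, hdeg, hf]
    simp [Polynomial.coeff_X, Polynomial.coeff_one, show s ≠ 0 by lia]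
  have hf0 : f ≠ 0 := hmonic.ne_zero
  have hnt : Nontrivial (AdjoinRoot f) :=
    AdjoinRoot.nontrivial f (by
      rw [Polynomial.degree_eq_natDegree hf0, hdeg]
      exact_mod_cast (by lia : s + 1 ≠ 0))
  have hdvd : f ∣ Polynomial.X ^ Fintype.card L - Polynomial.X := by
    rw [← AdjoinRoot.mk_eq_zero, map_sub, map_pow, AdjoinRoot.mk_X, hcard, sub_eq_zero]
    have hroot : AdjoinRoot.root f ^ (s + 1) + AdjoinRoot.root f + 1 = 0 := by
      have h4 : AdjoinRoot.mk f (Polynomial.X ^ (s + 1) + Polynomial.X + 1) = 0 :=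
        AdjoinRoot.mk_self (f := f)
      simpa using h4
    have h3 := (pow_sq_mul_of_root (k := k) hk hroot).2
    rw [show 6 = 3 + 3 from rfl, pow_add, pow_mul, h3, h3]
  have hX0 : (Polynomial.X ^ Fintype.card L - Polynomial.X : L[X]) ≠ 0 :=
    FiniteField.X_pow_card_sub_X_ne_zero L (hcard ▸ h1card)
  have hle := Polynomial.roots.le_of_dvd hX0 hdvd
  rw [FiniteField.roots_X_pow_card_sub_X] at hle
  have hnd : f.roots.Nodup := Multiset.nodup_of_le hle Finset.univ.nodup
  have hsplit : f.Splits := by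
    refine Polynomial.Splits.of_dvd (Polynomial.splits_iff_card_roots.2 ?_) hX0 hdvd
    rw [FiniteField.roots_X_pow_card_sub_X,
      FiniteField.X_pow_card_sub_X_natDegree_eq L (hcard ▸ h1card)]
    rfl
  have hval : f.roots.toFinset.val = f.roots := by
    rw [Multiset.toFinset_val, hnd.dedup]
  refine ⟨f.roots.toFinset, fun x => ?_, ?_, ?_⟩
  · rw [Multiset.mem_toFinset, Polynomial.mem_roots hf0, Polynomial.IsRoot.def, hf]
    simp
  · rw [Finset.card, hval, ← hdeg, Polynomial.splits_iff_card_roots.1 hsplit]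
  · have := hsplit.eq_prod_roots_of_monic hmonic
    rw [Finset.prod, hval]
    exact this.symm

/-- Hilbert 90 for the roots of `x ^ (s + 1) + x + 1`, which have norm `1`. -/
theorem exists_eq_mul_pow_of_root (hs3 : 3 ≤ s) (hk : Nat.card k = s ^ 2)
    (hL : Module.finrank k L = 3) {x : L} (hx : x ^ (s + 1) + x + 1 = 0) :
    ∃ y : L, y ≠ 0 ∧ y = x * y ^ s ^ 2 := by
  have := finite_of_finrank hL
  obtain ⟨h1, h2⟩ := pow_sq_mul_of_root (k := k) hk hx
  have h4 : x ^ s ^ 4 = x ^ s := by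
    rw [pow_succ s 3, pow_mul, h2]
  have hnorm : x ^ (s ^ 4 + s ^ 2 + 1) = 1 := by
    rw [pow_succ, pow_add, h4]
    rw [pow_succ] at hx
    linear_combination x ^ s ^ 2 * hx - h1
  obtain ⟨m, hm⟩ : ∃ m, s ^ 2 = m + 1 :=
    Nat.exists_eq_add_one_of_ne_zero (pow_ne_zero 2 (by lia))
  obtain ⟨y, hy0, hy⟩ := exists_pow_eq_of_pow_eq_one (d := m) (e := s ^ 4 + s ^ 2 + 1) (x := x) (by
    rw [card_cubic hk hL, show s ^ 6 = (s ^ 2) ^ 3 by ring, show s ^ 4 = (s ^ 2) ^ 2 by ring, hm]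
    ring) hnorm (by lia)
  refine ⟨y⁻¹, inv_ne_zero hy0, ?_⟩
  rw [← hy, hm, inv_pow, pow_succ]
  field_simp

end Roots

/-! ### Tangents at the point `1` -/

section Tangents

variable {k L : Type*} [Field k] [Finite k] [Field L] [Algebra k L] {s : ℕ}

theorem sub_pow_ne_zero (hk : Nat.card k = s ^ 2) (hL : Module.finrank k L = 3) {y : L}
    (hy : y ∉ (algebraMap k L).range) : y - y ^ s ^ 4 ≠ 0 := by
  intro h
  refine hy (mem_range_of_pow_eq hk hL ?_)
  rw [sub_eq_zero] at h
  conv_lhs => rw [h, ← pow_mul, ← pow_add, pow_six_eq hk hL]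

/-- The line of two distinct points `1` and `y`, in the coordinates of the Singer frame. -/
theorem mul_eq_of_trace_eq_zero (hk : Nat.card k = s ^ 2) (hL : Module.finrank k L = 3) {x y : L}
    (hx : Algebra.trace k L x = 0) (hy : Algebra.trace k L (y * x) = 0) :
    (y - y ^ s ^ 4) * x = -(y ^ s ^ 2 - y ^ s ^ 4) * x ^ s ^ 2 := by
  have h1 := algebraMap_trace hk hL x
  have h2 := algebraMap_trace hk hL (y * x)
  rw [hx, map_zero] at h1
  rw [hy, map_zero, mul_pow, mul_pow] at h2
  linear_combination y ^ s ^ 4 * h1 - h2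

theorem traceMul_ne_zero (hL : Module.finrank k L = 3) {x : L} (hx : x ≠ 0) :
    traceMul k x ≠ 0 := by
  intro h
  obtain ⟨y, hy⟩ := exists_trace_mul_ne_zero hL hx
  have h1 := LinearMap.congr_fun h y
  rw [traceMul_apply, mul_comm] at h1
  exact hy h1

omit [Finite k] in
theorem exists_notMem_range_trace_eq_zero (hL : Module.finrank k L = 3) (x : L) :
    ∃ y : L, y ∉ (algebraMap k L).range ∧ Algebra.trace k L (y * x) = 0 := by
  have := module_finite_of_finrank hL
  by_contra! h
  have h1 : LinearMap.ker (traceMul k x) ≤ Submodule.span k {(1 : L)} := by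
    intro y hy
    by_contra hy1
    refine h y (fun hy2 => hy1 ?_) hy
    obtain ⟨c, rfl⟩ := hy2
    rw [Algebra.algebraMap_eq_smul_one]
    exact Submodule.smul_mem _ _ (Submodule.mem_span_singleton_self _)
  have h2 := Submodule.finrank_mono h1
  rw [finrank_span_singleton one_ne_zero] at h2
  have h3 := LinearMap.finrank_range_add_finrank_ker (traceMul k x)
  have h4 := Submodule.finrank_le (LinearMap.range (traceMul k x))
  rw [Module.finrank_self] at h4
  lia

/-- A line whose Singer coordinate `y` has the ratio `y / y ^ q` among the roots of
`x ^ (s + 1) + x + 1` passes through the point `1` and through no other point of the norm-one group: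
with a point `z` it would also contain `z⁻¹`, because its coordinate is, up to a factor in `k`,
invariant under the involution. -/
theorem isTangent_of_root (hk : Nat.card k = s ^ 2) (hL : Module.finrank k L = 3) {x y : L}
    (hx : x ^ (s + 1) + x + 1 = 0) (hy0 : y ≠ 0) (hy : y = x * y ^ s ^ 2) :
    Algebra.trace k L y = 0 ∧ ∀ z : L, z ^ (s ^ 3 + 1) = 1 → Algebra.trace k L (z * y) = 0 →
      z ∈ (algebraMap k L).range := by
  obtain ⟨h1, h2⟩ := pow_sq_mul_of_root (k := k) hk hx
  have hx0 : x ≠ 0 := by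
    rintro rfl
    simp at hx
  have ht : Algebra.trace k L y = 0 := by
    apply (algebraMap k L).injective
    rw [algebraMap_trace hk hL, map_zero]
    have h3 : y ^ s ^ 2 = x ^ s ^ 2 * y ^ s ^ 4 := by
      conv_lhs => rw [hy, mul_pow, ← pow_mul, ← pow_add]
    rw [h3] at hy ⊢
    linear_combination hy + y ^ s ^ 4 * h1
  refine ⟨ht, fun z hz hzt => ?_⟩
  have hz0 := ne_zero_of_pow_eq_one hz
  obtain ⟨v, hv⟩ : y ^ s ^ 3 / y ∈ (algebraMap k L).range := by
    apply mem_range_of_pow_eq hk hL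
    have h3 : (y ^ s ^ 3) = x * (y ^ s ^ 3) ^ s ^ 2 := by
      conv_lhs => rw [hy, mul_pow, h2, ← pow_mul, mul_comm (s ^ 2), pow_mul]
    have h4 : y ^ s ^ 2 ≠ 0 := pow_ne_zero _ hy0
    rw [div_pow, div_eq_div_iff h4 hy0]
    generalize (y ^ s ^ 3) ^ s ^ 2 = A at *
    generalize y ^ s ^ 3 = B at *
    generalize y ^ s ^ 2 = D at *
    rw [h3, hy]
    ring
  have hvy : y ^ s ^ 3 = v • y := by
    rw [Algebra.smul_def, hv, div_mul_cancel₀ _ hy0]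
  have hv0 : v ≠ 0 := by
    rintro rfl
    rw [zero_smul] at hvy
    exact pow_ne_zero _ hy0 hvy
  have hzi : Algebra.trace k L (z⁻¹ * y) = 0 := by
    have h3 := trace_pow_cube hk hL (z * y)
    have hs0 : s ≠ 0 := by
      rintro rfl
      exact Nat.card_pos.ne' (hk.trans (zero_pow two_ne_zero))
    rw [hzt, zero_pow hs0, mul_pow, pow_cube_eq_inv hz, hvy, mul_smul_comm, map_smul, smul_eq_mul]
      at h3
    exact (mul_eq_zero.1 h3).resolve_left hv0
  rcases proportional_of_functional hk hL (one_pow _) hz (by rw [inv_pow, hz, inv_one])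
    (traceMul_ne_zero hL hy0) (by rw [traceMul_apply, one_mul, ht]) hzt hzi with h | h | h
  · exact mem_range_of_proportional_one (h.symm one_ne_zero)
  · obtain ⟨c, hc⟩ := mem_range_of_proportional_one (h.symm one_ne_zero)
    exact ⟨c⁻¹, by rw [map_inv₀, hc, inv_inv]⟩
  · obtain ⟨c, hc⟩ := h
    refine mem_range_of_quadratic hL (a := 1) (b := 0) (c := -c) one_ne_zero ?_
    rw [Algebra.smul_def, eq_mul_inv_iff_mul_eq₀ hz0] at hc
    rw [map_one, map_zero, map_neg, ← hc]
    ring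

/-- Conversely, a line through the point `1` and no other point of the norm-one group is
one of these. If `y` is another point of the line and `1`, `y`, `y ^ (s ^ 3)` are independent,
then expanding `y * y ^ (s ^ 3)` in this basis shows that some `y - c` has its norm
`(y - c) ^ (s ^ 3 + 1)` in `k`, so that it represents a point of the group. -/
theorem root_of_isTangent (hs3 : 3 ≤ s) (hs : Odd s) (hk : Nat.card k = s ^ 2)
    (hL : Module.finrank k L = 3) {l : L} (hl0 : l ≠ 0) (hl : Algebra.trace k L l = 0)
    (hz : ∀ z : L, z ^ (s ^ 3 + 1) = 1 → Algebra.trace k L (z * l) = 0 →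
      z ∈ (algebraMap k L).range) :
    (l / l ^ s ^ 2) ^ (s + 1) + l / l ^ s ^ 2 + 1 = 0 := by
  obtain ⟨y, hy, hyl⟩ := exists_notMem_range_trace_eq_zero (k := k) hL l
  have hs0 : s ≠ 0 := by lia
  have hbar : ∀ u v : L, (u + v) ^ s ^ 3 = u ^ s ^ 3 + v ^ s ^ 3 := by
    intro x y
    simp only [pow_succ s, pow_zero, one_mul, pow_mul, ← powHom_apply L hk, map_add]
  have hbark : ∀ c : k, (algebraMap k L c) ^ s ^ 3 = algebraMap k L (c ^ s) := by
    intro c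
    rw [← map_pow, pow_cube_eq hk]
  have hyy := pow_cube_pow_cube hk hL y
  -- `y ^ (s ^ 3)` lies on the line as well
  have hyb : Algebra.trace k L (y ^ s ^ 3 * l) = 0 := by
    by_cases hind : LinearIndependent k ![1, y, y ^ s ^ 3]
    · exfalso
      obtain ⟨e, he⟩ := basis_of_linearIndependent hL hind
      have hexp := e.sum_repr (y * y ^ s ^ 3)
      rw [he, Fin.sum_univ_three] at hexp
      set a := e.repr (y * y ^ s ^ 3) 0
      set b := e.repr (y * y ^ s ^ 3) 1
      set c := e.repr (y * y ^ s ^ 3) 2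
      simp only [Fin.isValue, Matrix.cons_val, Algebra.smul_def, mul_one] at hexp
      have hexp' := congrArg (· ^ s ^ 3) hexp
      simp only [hbar, mul_pow, hbark, hyy] at hexp'
      have hbc : b - c ^ s = 0 := by
        have hrel : ∑ i, ![a - a ^ s, b - c ^ s, c - b ^ s] i • ![1, y, y ^ s ^ 3] i = 0 := by
          simp only [Fin.sum_univ_three, Fin.isValue, Matrix.cons_val, Algebra.smul_def, map_sub]
          linear_combination hexp - hexp'
        exact Fintype.linearIndependent_iff.1 hind _ hrel 1
      rw [sub_eq_zero] at hbc
      set w := y - algebraMap k L c with hw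
      have hw0 : w ≠ 0 := by
        intro h
        rw [hw, sub_eq_zero] at h
        exact hy ⟨c, h.symm⟩
      have hwb : w ^ s ^ 3 = y ^ s ^ 3 - algebraMap k L b := by
        rw [hw, sub_eq_add_neg, hbar, ← map_neg, hbark, hs.neg_pow, ← hbc, map_neg, sub_eq_add_neg]
      have hww : w * w ^ s ^ 3 = algebraMap k L (a + b * c) := by
        rw [hwb, hw, map_add, map_mul]
        linear_combination -hexp
      have hd0 : a + b * c ≠ 0 := by
        intro h
        rw [h, map_zero] at hww
        exact mul_ne_zero hw0 (pow_ne_zero _ hw0) hww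
      have hds : (a + b * c) ^ s = a + b * c := by
        apply (algebraMap k L).injective
        rw [← hbark, ← hww, mul_pow, pow_cube_pow_cube hk hL, mul_comm]
      obtain ⟨t, ht0, ht⟩ := exists_pow_add_one_eq hs3 hk hds hd0
      have ht0' : algebraMap k L t ≠ 0 := by simpa using ht0
      have hz1 : (w / algebraMap k L t) ^ (s ^ 3 + 1) = 1 := by
        rw [div_pow, pow_succ', hww, ← ht, pow_succ' (algebraMap k L t), hbark, ← map_mul,
          ← pow_succ', div_self]
        simpa using ht0
      obtain ⟨d, hd⟩ := hz _ hz1 (by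
        have : w / algebraMap k L t * l = t⁻¹ • (y * l - c • l) := by
          rw [hw, Algebra.smul_def, Algebra.smul_def, map_inv₀]
          field_simp
        rw [this, map_smul, map_sub, map_smul, hyl, hl]
        simp)
      refine hy ⟨d * t + c, ?_⟩
      rw [map_add, map_mul, hd, div_mul_cancel₀ _ ht0', hw, sub_add_cancel]
    · rw [Fintype.not_linearIndependent_iff] at hind
      obtain ⟨g, hg, i, hi⟩ := hind
      simp only [Fin.sum_univ_three, Fin.isValue, Matrix.cons_val] at hg
      have hg2 : g 2 ≠ 0 := by
        intro h2
        rw [h2, zero_smul, add_zero] at hg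
        have hg1 : g 1 = 0 := by
          by_contra h1
          rw [add_comm] at hg
          exact hy (mem_range_of_proportional_one (proportional_of_add_eq_zero h1 hg))
        rw [hg1, zero_smul, add_zero] at hg
        have hg0 : g 0 = 0 := (smul_eq_zero.1 hg).resolve_right one_ne_zero
        fin_cases i
        · exact hi hg0
        · exact hi hg1
        · exact hi h2
      have h3 : Algebra.trace k L ((g 0 • (1 : L) + g 1 • y + g 2 • y ^ s ^ 3) * l) = 0 := by
        rw [hg, zero_mul, map_zero]
      simp only [add_mul, smul_mul_assoc, one_mul, map_add, map_smul, hl, hyl, mul_zero,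
        zero_add, smul_eq_mul] at h3
      exact (mul_eq_zero.1 h3).resolve_left hg2
  -- hence the ratio is fixed by the involution
  have hlb : Algebra.trace k L (l ^ s ^ 3) = 0 := by
    rw [trace_pow_cube hk hL, hl, zero_pow hs0]
  have hylb : Algebra.trace k L (y * l ^ s ^ 3) = 0 := by
    have := trace_pow_cube hk hL (y ^ s ^ 3 * l)
    rwa [hyb, zero_pow hs0, mul_pow, hyy] at this
  have r1 := mul_eq_of_trace_eq_zero hk hL hl hyl
  have r2 := mul_eq_of_trace_eq_zero hk hL hlb hylb
  have hne := sub_pow_ne_zero hk hL hy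
  have hl2 : l ^ s ^ 2 ≠ 0 := pow_ne_zero _ hl0
  have hl3 : (l ^ s ^ 3) ^ s ^ 2 ≠ 0 := pow_ne_zero _ (pow_ne_zero _ hl0)
  set x := l / l ^ s ^ 2 with hx
  have hx0 : x ≠ 0 := div_ne_zero hl0 hl2
  have hxb : x ^ s ^ 3 = x := by
    rw [hx, div_pow, ← pow_mul l (s ^ 2), mul_comm, pow_mul, div_eq_div_iff hl3 hl2]
    apply mul_left_cancel₀ hne
    linear_combination l ^ s ^ 2 * r2 - (l ^ s ^ 3) ^ s ^ 2 * r1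
  have htr := algebraMap_trace hk hL l
  rw [hl, map_zero] at htr
  have hxq : x ^ s ^ 2 * (x + 1) = -1 := by
    have h4 : (l ^ s ^ 2) ^ s ^ 2 = l ^ s ^ 4 := by rw [← pow_mul, ← pow_add]
    have hl4 : l ^ s ^ 4 ≠ 0 := pow_ne_zero _ hl0
    rw [hx, div_pow, h4]
    field_simp
    linear_combination -htr
  have h5 := congrArg (powHom (k := k) L hk) hxq
  simp only [map_add, map_mul, map_one, map_neg, powHom_apply, ← pow_mul, ← pow_succ, hxb] at h5
  rw [pow_succ]
  linear_combination h5

end Tangents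

/-! ### The envelope at the point `1` -/

section Pencil

/-- Homogenization of `∏ (X - x) = X ^ (s + 1) + X + 1`. -/
theorem prod_sub_mul {L A : Type*} [Field L] [CommRing A] [IsDomain A] [Algebra L A] {s : ℕ}
    {W : Finset L} (hs : s ≠ 0) (hcard : W.card = s + 1)
    (hW : ∏ x ∈ W, (Polynomial.X - Polynomial.C x) =
        (Polynomial.X ^ (s + 1) + Polynomial.X + 1 : Polynomial L)) (u v : A) :
    ∏ x ∈ W, (u - algebraMap L A x * v) = u ^ (s + 1) + u * v ^ s + v ^ (s + 1) := by
  by_cases hv : v = 0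
  · subst hv
    simp [hcard, hs]
  · apply IsFractionRing.injective A (FractionRing A)
    have hv' : algebraMap A (FractionRing A) v ≠ 0 := by simpa using hv
    have h := congrArg (Polynomial.aeval
      (algebraMap A (FractionRing A) u / algebraMap A (FractionRing A) v)) hW
    simp only [map_prod, map_sub, map_add, map_pow, map_one, Polynomial.aeval_X,
      Polynomial.aeval_C] at h
    have h1 : ∀ x ∈ W, algebraMap A (FractionRing A) (u - algebraMap L A x * v) =
        algebraMap A (FractionRing A) v * (algebraMap A (FractionRing A) u /
          algebraMap A (FractionRing A) v - algebraMap L (FractionRing A) x) := by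
      intro x _
      rw [map_sub, map_mul, ← IsScalarTower.algebraMap_apply]
      field_simp
    rw [map_prod, Finset.prod_congr rfl h1, Finset.prod_mul_distrib, Finset.prod_const, hcard, h]
    simp only [map_add, map_mul, map_pow]
    have hu : algebraMap A (FractionRing A) u = algebraMap A (FractionRing A) u /
        algebraMap A (FractionRing A) v * algebraMap A (FractionRing A) v :=
      (div_mul_cancel₀ _ hv').symm
    generalize algebraMap A (FractionRing A) u / algebraMap A (FractionRing A) v = t at *
    rw [hu]
    ring

variable {k L : Type*} [Field k] [Finite k] [Field L] [Algebra k L] {s : ℕ}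

/-- On the line `x₀ + x₁ + x₂ = 0` the form `formG` is a perfect square. -/
theorem formG_eq_sq (hs : Odd s) {A : Type*} [CommRing A] {u v : A}
    (h : (u + v) ^ s = u ^ s + v ^ s) :
    formG s u v (-(u + v)) = (u ^ (s + 1) + u * v ^ s + v ^ (s + 1)) ^ 2 := by
  rw [formG_eq, hs.neg_pow, h]
  ring

theorem dvd_formG_sub_sq (hs : Odd s) (hk : Nat.card k = s ^ 2)
    (x₀ x₁ x₂ : MvPolynomial (Fin 3) L) :
    x₀ + x₁ + x₂ ∣ formG s x₀ x₁ x₂ - (x₀ ^ (s + 1) + x₀ * x₁ ^ s + x₁ ^ (s + 1)) ^ 2 := by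
  rw [← formG_eq_sq hs (by simp only [← powHom_apply (MvPolynomial (Fin 3) L) hk, map_add]),
    ← Ideal.mem_span_singleton, ← Ideal.Quotient.mk_eq_mk_iff_sub_mem, map_formG, map_formG]
  congr 1
  rw [Ideal.Quotient.mk_eq_mk_iff_sub_mem, Ideal.mem_span_singleton]
  exact dvd_of_eq (by ring)

omit [Finite k] in
theorem not_dvd_linSubst_formG (hs0 : s ≠ 0) {N N' : Matrix (Fin 3) (Fin 3) L} (h : N * N' = 1) :
    ¬ linForm N 0 + linForm N 1 + linForm N 2 ∣
      formG s (linForm N 0) (linForm N 1) (linForm N 2) := by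
  intro hd
  rw [← linSubst_formG, ← linSubst_X, ← linSubst_X, ← linSubst_X, ← map_add, ← map_add] at hd
  -- `formG` does not vanish at the point `(0, 1, -1)` of the line
  have h1 := map_dvd (eval (![0, 1, -1] : Fin 3 → L)) (dvd_of_linSubst_dvd h hd)
  rw [map_formG] at h1
  simp [formG, hs0] at h1

/-- The functional `y ↦ Tr(w y)` in the coordinates of a basis `f`. In the dual plane a line
is given by the coordinates of some `y` in the basis `f`, and `dualPoint f w` is the point that is
incident with the lines `y` such that `Tr(w y) = 0`. -/
noncomputable def dualPoint (f : Module.Basis (Fin 3) k L) : L →ₗ[k] (Fin 3 → k) :=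
  LinearMap.pi fun j => traceMul k (f j)

omit [Finite k] in
theorem dualPoint_apply (f : Module.Basis (Fin 3) k L) (w : L) (j : Fin 3) :
    dualPoint f w j = Algebra.trace k L (w * f j) := rfl

omit [Finite k] in
theorem dualPoint_dotProduct (f : Module.Basis (Fin 3) k L) (w : L) (y : Fin 3 → k) :
    dualPoint f w ⬝ᵥ y = Algebra.trace k L (w * f.equivFun.symm y) := by
  rw [Module.Basis.equivFun_symm_apply, Finset.mul_sum, map_sum]
  refine Finset.sum_congr rfl fun j _ => ?_
  rw [dualPoint_apply, mul_smul_comm, map_smul, smul_eq_mul, mul_comm]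

theorem dualPoint_injective (hL : Module.finrank k L = 3) (f : Module.Basis (Fin 3) k L) :
    Function.Injective (dualPoint f) := by
  rw [← LinearMap.ker_eq_bot, LinearMap.ker_eq_bot']
  intro w hw
  by_contra hw0
  obtain ⟨y, hy⟩ := exists_trace_mul_ne_zero (k := k) hL hw0
  apply hy
  rw [← f.equivFun.symm_apply_apply y, ← dualPoint_dotProduct, hw, zero_dotProduct]

theorem dualPoint_ne_zero (hL : Module.finrank k L = 3) (f : Module.Basis (Fin 3) k L) {w : L}
    (hw : w ≠ 0) : dualPoint f w ≠ 0 := by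
  intro h
  exact hw (dualPoint_injective hL f (h.trans (map_zero _).symm))

theorem mk_dualPoint_eq_iff (hL : Module.finrank k L = 3) (f : Module.Basis (Fin 3) k L) {w z : L}
    (hw : dualPoint f w ≠ 0) (hz : dualPoint f z ≠ 0) :
    Projectivization.mk k (dualPoint f w) hw = Projectivization.mk k (dualPoint f z) hz ↔
      Proportional k w z := by
  rw [Projectivization.mk_eq_mk_iff']
  refine exists_congr fun c => ?_
  rw [← map_smul, (dualPoint_injective hL f).eq_iff, eq_comm]

theorem map_sum_dualPoint (hk : Nat.card k = s ^ 2) (hL : Module.finrank k L = 3)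
    (f : Module.Basis (Fin 3) k L) (w : L) :
    map (algebraMap k L) (∑ j, C (dualPoint f w j) * X j) =
      C w * linForm (frame s f) 0 + C (w ^ s ^ 2) * linForm (frame s f) 1
        + C (w ^ s ^ 4) * linForm (frame s f) 2 := by
  simp only [map_sum, map_mul, map_C, map_X, dualPoint_apply, algebraMap_trace hk hL, linForm,
    frame_apply, Finset.mul_sum, ← Finset.sum_add_distrib]
  refine Finset.sum_congr rfl fun j _ => ?_
  simp only [Fin.isValue, Fin.coe_ofNat_eq_mod, Nat.zero_mod, Nat.one_mod, Nat.reduceMod, pow_zero,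
    pow_one, ← pow_mul, Nat.reduceMul, mul_pow, map_add, map_mul]
  ring

omit [Finite k] in
theorem pencilForm_mk (v : Fin 3 → k) (hv : v ≠ 0) :
    ∃ u : k, u ≠ 0 ∧ pencilForm (Projectivization.mk k v hv) = C u * ∑ j, C (v j) * X j := by
  obtain ⟨u, hu⟩ := Projectivization.exists_smul_eq_mk_rep k v hv
  refine ⟨u, u.ne_zero, ?_⟩
  rw [pencilForm, ← hu, Finset.mul_sum]
  refine Finset.sum_congr rfl fun j _ => ?_
  rw [Pi.smul_apply, Units.smul_def, smul_eq_mul, C_mul, mul_assoc]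

/-- The element of `L` that gives a line of the dual plane. -/
noncomputable def lineCoord (f : Module.Basis (Fin 3) k L) (l : ℙ k (Fin 3 → k)) : L :=
  f.equivFun.symm l.rep

omit [Finite k] in
theorem lineCoord_ne_zero (f : Module.Basis (Fin 3) k L) (l : ℙ k (Fin 3 → k)) :
    lineCoord f l ≠ 0 := by
  rw [lineCoord, Ne, LinearEquiv.map_eq_zero_iff]
  exact l.rep_nonzero

omit [Finite k] in
theorem orthogonal_mk_dualPoint_iff (f : Module.Basis (Fin 3) k L) {w : L}
    (hw : dualPoint f w ≠ 0) (l : ℙ k (Fin 3 → k)) :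
    (Projectivization.mk k (dualPoint f w) hw).orthogonal l ↔
      Algebra.trace k L (w * lineCoord f l) = 0 := by
  conv_lhs => rw [← l.mk_rep]
  rw [Projectivization.orthogonal_mk, dualPoint_dotProduct, lineCoord]

omit [Finite k] in
theorem lineCoord_injective (f : Module.Basis (Fin 3) k L) {l m : ℙ k (Fin 3 → k)}
    (h : Proportional k (lineCoord f l) (lineCoord f m)) : l = m := by
  obtain ⟨c, hc⟩ := h
  rw [← l.mk_rep, ← m.mk_rep, Projectivization.mk_eq_mk_iff']
  refine ⟨c, f.equivFun.symm.injective ?_⟩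
  rw [map_smul]
  exact hc.symm

omit [Finite k] in
theorem exists_lineCoord (f : Module.Basis (Fin 3) k L) {y : L} (hy : y ≠ 0) :
    ∃ l : ℙ k (Fin 3 → k), Proportional k (lineCoord f l) y := by
  have h : f.equivFun y ≠ 0 := by simpa using hy
  obtain ⟨u, hu⟩ := Projectivization.exists_smul_eq_mk_rep k (f.equivFun y) h
  refine ⟨Projectivization.mk k _ h, u, ?_⟩
  rw [lineCoord, ← hu, Units.smul_def, map_smul, LinearEquiv.symm_apply_apply]

/-- The points of the dual frame that come from the group `z ^ (s ^ 3 + 1) = 1`. -/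
def dualArc (s : ℕ) (f : Module.Basis (Fin 3) k L) : Set (ℙ k (Fin 3 → k)) :=
  {P | ∃ z : L, z ^ (s ^ 3 + 1) = 1 ∧ ∃ h : dualPoint f z ≠ 0, P = Projectivization.mk k _ h}

theorem mem_tangents_dualArc_iff (hL : Module.finrank k L = 3) (f : Module.Basis (Fin 3) k L)
    (h1 : dualPoint f 1 ≠ 0) (l : ℙ k (Fin 3 → k)) :
    l ∈ tangents (dualArc s f) (Projectivization.mk k _ h1) ↔
      Algebra.trace k L (lineCoord f l) = 0 ∧
        ∀ z : L, z ^ (s ^ 3 + 1) = 1 → Algebra.trace k L (z * lineCoord f l) = 0 →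
          z ∈ (algebraMap k L).range := by
  have h1mem : Projectivization.mk k _ h1 ∈ dualArc s f := ⟨1, one_pow _, h1, rfl⟩
  simp only [tangents, Set.mem_ofPred_eq]
  constructor
  · intro h
    have h2 : Projectivization.mk k _ h1 ∈ {R ∈ dualArc s f | R.orthogonal l} := by
      rw [h]
      rfl
    refine ⟨?_, fun z hz hzt => ?_⟩
    · have := (orthogonal_mk_dualPoint_iff f h1 l).1 h2.2
      rwa [one_mul] at this
    · have hz0 := dualPoint_ne_zero hL f (ne_zero_of_pow_eq_one hz)
      have h3 : Projectivization.mk k _ hz0 ∈ {R ∈ dualArc s f | R.orthogonal l} :=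
        ⟨⟨z, hz, hz0, rfl⟩, (orthogonal_mk_dualPoint_iff f hz0 l).2 hzt⟩
      rw [h, Set.mem_singleton_iff, mk_dualPoint_eq_iff hL] at h3
      exact mem_range_of_proportional_one h3
  · rintro ⟨ht, h⟩
    ext R
    rw [Set.mem_singleton_iff]
    constructor
    · rintro ⟨⟨z, hz, hz0, rfl⟩, hR⟩
      rw [orthogonal_mk_dualPoint_iff] at hR
      obtain ⟨c, hc⟩ := h z hz hR
      rw [mk_dualPoint_eq_iff hL]
      exact ⟨c, by rw [← hc, Algebra.algebraMap_eq_smul_one]⟩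
    · rintro rfl
      refine ⟨h1mem, ?_⟩
      rw [orthogonal_mk_dualPoint_iff, one_mul]
      exact ht

/-- The tangents at the point `1` correspond to the roots of `x ^ (s + 1) + x + 1`. -/
theorem bijOn_tangents (hs3 : 3 ≤ s) (hs : Odd s) (hk : Nat.card k = s ^ 2)
    (hL : Module.finrank k L = 3) (f : Module.Basis (Fin 3) k L) (h1 : dualPoint f 1 ≠ 0)
    {W : Finset L} (hW : ∀ x, x ∈ W ↔ x ^ (s + 1) + x + 1 = 0) :
    Set.BijOn (fun l => lineCoord f l / lineCoord f l ^ s ^ 2)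
      (tangents (dualArc s f) (Projectivization.mk k _ h1)) W := by
  refine ⟨fun l hl => ?_, fun l _ m _ hlm => ?_, fun x hx => ?_⟩
  · rw [mem_tangents_dualArc_iff hL] at hl
    exact (hW _).2 (root_of_isTangent hs3 hs hk hL (lineCoord_ne_zero f l) hl.1 hl.2)
  · have hl0 := lineCoord_ne_zero f l
    have hm0 := lineCoord_ne_zero f m
    obtain ⟨c, hc⟩ : lineCoord f l / lineCoord f m ∈ (algebraMap k L).range := by
      apply mem_range_of_pow_eq hk hL
      have hl1 := pow_ne_zero (s ^ 2) hl0
      have hm1 := pow_ne_zero (s ^ 2) hm0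
      simp only [div_eq_div_iff hl1 hm1] at hlm
      rw [div_pow, div_eq_div_iff hm1 hm0]
      linear_combination -hlm
    refine lineCoord_injective f ⟨c, ?_⟩
    rw [Algebra.smul_def, hc, div_mul_cancel₀ _ hm0]
  · have hx' := (hW x).1 hx
    obtain ⟨y, hy0, hy⟩ := exists_eq_mul_pow_of_root hs3 hk hL hx'
    obtain ⟨l, c, hc⟩ := exists_lineCoord f hy0
    have hl : lineCoord f l = x * lineCoord f l ^ s ^ 2 := by
      rw [hc, Algebra.smul_def, mul_pow, algebraMap_pow_sq hk]
      conv_lhs => rw [hy]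
      ring
    refine ⟨l, ?_, ?_⟩
    · rw [mem_tangents_dualArc_iff hL]
      exact isTangent_of_root hk hL hx' (lineCoord_ne_zero f l) hl
    · have hl1 := pow_ne_zero (s ^ 2) (lineCoord_ne_zero f l)
      exact (div_eq_iff hl1).2 hl

/-- Modulo the pencil of the point `1`, a second point `y` of the line `l` cuts the pencil
in the linear form that belongs to the root of `l`. -/
theorem dvd_pencil_sub (hk : Nat.card k = s ^ 2) (hL : Module.finrank k L = 3)
    (f : Module.Basis (Fin 3) k L) {y l : L} (hl0 : l ≠ 0) (hl : Algebra.trace k L l = 0)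
    (hyl : Algebra.trace k L (y * l) = 0) :
    linForm (frame s f) 0 + linForm (frame s f) 1 + linForm (frame s f) 2 ∣
      map (algebraMap k L) (∑ j, C (dualPoint f y j) * X j)
        - C (y - y ^ s ^ 4) *
          (linForm (frame s f) 0 - C (l / l ^ s ^ 2) * linForm (frame s f) 1) := by
  have hl1 := pow_ne_zero (s ^ 2) hl0
  have h1 : y ^ s ^ 2 - y ^ s ^ 4 = -((y - y ^ s ^ 4) * (l / l ^ s ^ 2)) := by
    have := mul_eq_of_trace_eq_zero hk hL hl hyl
    field_simp
    linear_combination this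
  refine ⟨C (y ^ s ^ 4), ?_⟩
  rw [map_sum_dualPoint hk hL]
  have h2 := congrArg (C : L →+* MvPolynomial (Fin 3) L) h1
  simp only [map_sub, map_neg, map_mul] at h2 ⊢
  linear_combination h2 * linForm (frame s f) 1

/-- The envelope condition at the point `1` of the dual arc. -/
theorem envelope_at_one (hs3 : 3 ≤ s) (hs : Odd s) (hk : Nat.card k = s ^ 2)
    (hL : Module.finrank k L = 3) (f : Module.Basis (Fin 3) k L) {F : MvPolynomial (Fin 3) k}
    (hF : map (algebraMap k L) F = formG s (linForm (frame s f) 0) (linForm (frame s f) 1)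
      (linForm (frame s f) 2)) {P : ℙ k (Fin 3 → k)} (h1 : dualPoint f 1 ≠ 0)
    (hP : P = Projectivization.mk k _ h1) :
    (tangents (dualArc s f) P).ncard = s + 1 ∧
      ∃ (c : k) (Q : ℙ k (Fin 3 → k) → ℙ k (Fin 3 → k)), c ≠ 0 ∧
        (∀ l ∈ tangents (dualArc s f) P, Q l ≠ P ∧ (Q l).orthogonal l) ∧
        pencilForm P ∣ F - C c * ∏ᶠ l ∈ tangents (dualArc s f) P, pencilForm (Q l) ^ 2 := by
  classical
  subst hP
  have hs0 : s ≠ 0 := by lia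
  obtain ⟨W, hW, hWcard, hWprod⟩ := exists_finset_roots hs3 hk hL
  have hbij := bijOn_tangents hs3 hs hk hL f h1 hW
  set Tn := tangents (dualArc s f) (Projectivization.mk k _ h1) with hTn
  have hmem : ∀ l ∈ Tn, Algebra.trace k L (lineCoord f l) = 0 := fun l hl =>
    ((mem_tangents_dualArc_iff hL f h1 l).1 hl).1
  refine ⟨?_, ?_⟩
  · rw [← hbij.injOn.ncard_image, hbij.image_eq, Set.ncard_coe_finset, hWcard]
  have hfin : Tn.Finite := Set.toFinite _
  -- the second point of each line
  choose y hyr hyt using fun l : ℙ k (Fin 3 → k) =>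
    exists_notMem_range_trace_eq_zero (k := k) hL (lineCoord f l)
  have hy0 : ∀ l, dualPoint f (y l) ≠ 0 := fun l => dualPoint_ne_zero hL f (by
    intro h
    exact hyr l (h ▸ zero_mem _))
  set Q : ℙ k (Fin 3 → k) → ℙ k (Fin 3 → k) := fun l => Projectivization.mk k _ (hy0 l) with hQ
  choose u hu0 hu using fun l => pencilForm_mk _ (hy0 l)
  obtain ⟨v, hv0, hv⟩ := pencilForm_mk _ h1
  set D := linForm (frame s f) 0 + linForm (frame s f) 1 + linForm (frame s f) 2 with hD
  have hpD : map (algebraMap k L) (pencilForm (Projectivization.mk k _ h1)) =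
      C (algebraMap k L v) * D := by
    rw [hv, map_mul, map_C, map_sum_dualPoint hk hL]
    simp [hD]
  have hvunit : IsUnit (C (algebraMap k L v) : MvPolynomial (Fin 3) L) :=
    (Ne.isUnit (by simpa using hv0)).map C
  set κ : ℙ k (Fin 3 → k) → L := fun l => algebraMap k L (u l) * (y l - y l ^ s ^ 4) with hκ
  have hκ0 : ∀ l, κ l ≠ 0 := fun l =>
    mul_ne_zero (by simpa using hu0 l) (sub_pow_ne_zero hk hL (hyr l))
  set ρ : ℙ k (Fin 3 → k) → L := fun l => lineCoord f l / lineCoord f l ^ s ^ 2 with hρ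
  set g := ∏ᶠ l ∈ Tn, pencilForm (Q l) ^ 2 with hg
  set c : L := ∏ l ∈ hfin.toFinset, (κ l ^ 2)⁻¹ with hc
  have hc0 : c ≠ 0 := Finset.prod_ne_zero_iff.2 fun l _ => inv_ne_zero (pow_ne_zero 2 (hκ0 l))
  have hpencil : ∀ l ∈ Tn, D ∣ map (algebraMap k L) (pencilForm (Q l)) -
      C (κ l) * (linForm (frame s f) 0 - C (ρ l) * linForm (frame s f) 1) := by
    intro l hl
    rw [hu, map_mul, map_C, hκ, C_mul, mul_assoc, ← mul_sub]
    exact (dvd_pencil_sub hk hL f (lineCoord_ne_zero f l) (hmem l hl) (hyt l)).mul_left _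
  have hprod : ∏ l ∈ hfin.toFinset,
      (linForm (frame s f) 0 - C (ρ l) * linForm (frame s f) 1) =
      linForm (frame s f) 0 ^ (s + 1) + linForm (frame s f) 0 * linForm (frame s f) 1 ^ s
        + linForm (frame s f) 1 ^ (s + 1) := by
    rw [← prod_sub_mul hs0 hWcard hWprod]
    refine Finset.prod_nbij ρ (fun l hl => hbij.mapsTo (hfin.mem_toFinset.1 hl)) ?_ ?_
      (fun l _ => rfl)
    · rw [hfin.coe_toFinset]
      exact hbij.injOn
    · rw [hfin.coe_toFinset]
      exact hbij.surjOn
  have hmain : D ∣ map (algebraMap k L) F - C c * map (algebraMap k L) g := by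
    have hk1 := fun l hl => (Ideal.Quotient.mk_eq_mk_iff_sub_mem _ _).2
      (Ideal.mem_span_singleton.2 (hpencil l hl))
    have hk2 := (Ideal.Quotient.mk_eq_mk_iff_sub_mem _ _).2 (Ideal.mem_span_singleton.2
      (dvd_formG_sub_sq (k := k) hs hk (linForm (frame s f) 0) (linForm (frame s f) 1)
        (linForm (frame s f) 2)))
    rw [← Ideal.mem_span_singleton, ← Ideal.Quotient.mk_eq_mk_iff_sub_mem, hF, hk2, ← hprod,
      hg, finprod_mem_eq_finite_toFinset_prod _ hfin, hc]
    simp only [map_mul, map_prod, map_pow]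
    rw [← Finset.prod_pow, ← Finset.prod_mul_distrib]
    refine Finset.prod_congr rfl fun l hl => ?_
    rw [hk1 l (hfin.mem_toFinset.1 hl), ← map_pow, ← map_pow, ← map_mul]
    congr 1
    have hone : (C (κ l ^ 2)⁻¹ : MvPolynomial (Fin 3) L) * C (κ l) ^ 2 = 1 := by
      rw [← C_pow, ← C_mul, inv_mul_cancel₀ (pow_ne_zero 2 (hκ0 l)), C_1]
    linear_combination -(linForm (frame s f) 0 - C (ρ l) * linForm (frame s f) 1) ^ 2 * hone
  have hmain' : map (algebraMap k L) (pencilForm (Projectivization.mk k _ h1)) ∣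
      map (algebraMap k L) F - C c * map (algebraMap k L) g := by
    rw [hpD]
    exact hvunit.mul_left_dvd.2 hmain
  have hndvd : ¬ pencilForm (Projectivization.mk k _ h1) ∣ g := by
    intro h
    have h2 := map_dvd (map (algebraMap k L)) h
    have h3 := (dvd_sub_left (h2.mul_left (C c))).1 hmain'
    rw [hpD, hF] at h3
    obtain ⟨M', hM'⟩ := frame_mul_eq_one hk hL f
    exact not_dvd_linSubst_formG hs0 hM' ((dvd_mul_left _ _).trans h3)
  obtain ⟨d, hd, hdvd⟩ := exists_algebraMap_eq_of_dvd_sub hmain' hndvd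
  refine ⟨d, Q, ?_, fun l hl => ⟨fun h => ?_, ?_⟩, hdvd⟩
  · rintro rfl
    exact hc0 (by rw [← hd, map_zero])
  · rw [hQ, mk_dualPoint_eq_iff hL] at h
    exact hyr l (mem_range_of_proportional_one h)
  · rw [hQ, orthogonal_mk_dualPoint_iff]
    exact hyt l

end Pencil

/-! ### Invariance under the norm-one group -/

section Invariance

variable {k L : Type*} [Field k] [Finite k] [Field L] [Algebra k L] {s : ℕ}

/-- A diagonal change of variables whose weights satisfy `w₁ w₂ ^ s = w₀ w₁ ^ s = w₀ ^ s w₂ = 1`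
leaves `formU` and `formG` invariant. -/
theorem formU_weights {R : Type*} [CommRing R] {w₀ w₁ w₂ : R} (h₁ : w₁ * w₂ ^ s = 1)
    (h₂ : w₀ * w₁ ^ s = 1) (h₃ : w₀ ^ s * w₂ = 1) (x₀ x₁ x₂ : R) :
    formU s (w₀ * x₀) (w₁ * x₁) (w₂ * x₂) = formU s x₀ x₁ x₂ := by
  simp only [formU, mul_pow]
  linear_combination x₁ * x₂ ^ s * h₁ + x₀ * x₁ ^ s * h₂ + x₀ ^ s * x₂ * h₃

theorem formG_weights {R : Type*} [CommRing R] {w₀ w₁ w₂ : R} (h₁ : w₁ * w₂ ^ s = 1)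
    (h₂ : w₀ * w₁ ^ s = 1) (h₃ : w₀ ^ s * w₂ = 1) (x₀ x₁ x₂ : R) :
    formG s (w₀ * x₀) (w₁ * x₁) (w₂ * x₂) = formG s x₀ x₁ x₂ := by
  have e₁ : w₁ * x₁ * (w₂ * x₂) ^ s = x₁ * x₂ ^ s := by
    rw [mul_pow]
    linear_combination x₁ * x₂ ^ s * h₁
  have e₂ : w₀ * x₀ * (w₁ * x₁) ^ s = x₀ * x₁ ^ s := by
    rw [mul_pow]
    linear_combination x₀ * x₁ ^ s * h₂
  have e₃ : (w₀ * x₀) ^ s * (w₂ * x₂) = x₀ ^ s * x₂ := by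
    rw [mul_pow]
    linear_combination x₀ ^ s * x₂ * h₃
  rw [formG_eq, formG_eq, e₁, e₂, e₃]

omit [Field k] [Finite k] [Algebra k L] in
theorem weights_of_pow_eq_one {z : L} (hz : z ^ (s ^ 3 + 1) = 1) :
    z ^ s ^ 2 * (z ^ s ^ 4) ^ s = 1 ∧ z * (z ^ s ^ 2) ^ s = 1 ∧ z ^ s * z ^ s ^ 4 = 1 := by
  refine ⟨?_, ?_, ?_⟩
  · rw [← pow_mul, ← pow_add, show s ^ 2 + s ^ 4 * s = (s ^ 3 + 1) * s ^ 2 by ring, pow_mul, hz,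
      one_pow]
  · rw [← pow_mul, ← pow_succ', show s ^ 2 * s + 1 = s ^ 3 + 1 by ring, hz]
  · rw [← pow_add, show s + s ^ 4 = (s ^ 3 + 1) * s by ring, pow_mul, hz, one_pow]

omit [Field k] [Finite k] [Algebra k L] in
theorem linForm_frame_smul (z : L) {f g : Fin 3 → L} (h : ∀ j, g j = z * f j) (i : Fin 3) :
    linForm (frame s g) i = C (z ^ (s ^ 2) ^ (i : ℕ)) * linForm (frame s f) i := by
  simp only [linForm, Finset.mul_sum, frame_apply, h, mul_pow, C_mul, mul_assoc]

omit [Field k] [Finite k] [Algebra k L] in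
theorem formG_frame_smul {z : L} (hz : z ^ (s ^ 3 + 1) = 1) {f g : Fin 3 → L}
    (h : ∀ j, g j = z * f j) :
    formG s (linForm (frame s g) 0) (linForm (frame s g) 1) (linForm (frame s g) 2) =
      formG s (linForm (frame s f) 0) (linForm (frame s f) 1) (linForm (frame s f) 2) := by
  obtain ⟨h₁, h₂, h₃⟩ := weights_of_pow_eq_one hz
  simp only [linForm_frame_smul z h, Fin.isValue, Fin.coe_ofNat_eq_mod, Nat.zero_mod, Nat.one_mod,
    Nat.reduceMod, pow_zero, pow_one, ← pow_mul, Nat.reduceMul]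
  refine formG_weights ?_ ?_ ?_ _ _ _
  · rw [← C_pow, ← C_mul, h₁, C_1]
  · rw [← C_pow, ← C_mul, h₂, C_1]
  · rw [← C_pow, ← C_mul, h₃, C_1]

omit [Finite k] in
theorem dualArc_smul {z : L} (hz : z ^ (s ^ 3 + 1) = 1)
    {f g : Module.Basis (Fin 3) k L} (h : ∀ j, g j = z * f j) : dualArc s g = dualArc s f := by
  have hz0 := ne_zero_of_pow_eq_one hz
  have hfg : ∀ w, dualPoint g w = dualPoint f (z * w) := by
    intro w
    ext j
    rw [dualPoint_apply, dualPoint_apply, h]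
    congr 1
    ring
  ext P
  constructor
  · rintro ⟨w, hw, h0, rfl⟩
    refine ⟨z * w, by rw [mul_pow, hz, hw, one_mul], ?_, ?_⟩
    · rwa [← hfg]
    · simp only [hfg]
  · rintro ⟨w, hw, h0, rfl⟩
    have h1 : z * (z⁻¹ * w) = w := mul_inv_cancel_left₀ hz0 w
    refine ⟨z⁻¹ * w, by rw [mul_pow, inv_pow, hz, hw, inv_one, one_mul], ?_, ?_⟩
    · rwa [hfg, h1]
    · simp only [hfg, h1]

/-- The curve of `formG` is an algebraic envelope of the dual arc. The multiplications by the
elements of the group `z ^ (s ^ 3 + 1) = 1` leave both invariant, so that it suffices to look at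
the point `1`. -/
theorem isAlgebraicEnvelope_dualArc (hs3 : 3 ≤ s) (hs : Odd s) (hk : Nat.card k = s ^ 2)
    (hL : Module.finrank k L = 3) (f : Module.Basis (Fin 3) k L) {F : MvPolynomial (Fin 3) k}
    (hF : map (algebraMap k L) F = formG s (linForm (frame s f) 0) (linForm (frame s f) 1)
      (linForm (frame s f) 2)) (hF0 : F ≠ 0) (hFh : F.IsHomogeneous (2 * (s + 1)))
    (hcard : (dualArc s f).ncard = s ^ 2 - s + 1) : IsAlgebraicEnvelope (dualArc s f) F := by
  refine ⟨s + 1, ?_, hF0, hFh, ?_⟩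
  · have : s ≤ s ^ 2 := Nat.le_self_pow two_ne_zero s
    rw [hcard, hk]
    lia
  · rintro P ⟨z, hz, h0, rfl⟩
    have hz0 := ne_zero_of_pow_eq_one hz
    obtain ⟨g, hg⟩ : ∃ g : Module.Basis (Fin 3) k L, ∀ j, g j = z * f j :=
      ⟨f.map (DistribMulAction.toLinearEquiv k L (Units.mk0 z hz0)), fun j => by
        simp [Units.smul_def]⟩
    have h1 : dualPoint g 1 = dualPoint f z := by
      ext j
      rw [dualPoint_apply, dualPoint_apply, hg, one_mul]
    rw [← dualArc_smul hz hg]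
    refine envelope_at_one hs3 hs hk hL g ?_ (h1 ▸ h0) (by simp only [h1])
    rw [formG_frame_smul hz hg, hF]

end Invariance

/-! ### The invariant arc -/

section SingerGroup

variable {k L : Type*} [Field k] [Finite k] [Field L] [Algebra k L] {s : ℕ}

/-- Multiplication by a unit of `L`, as a matrix in the coordinates of a basis. -/
noncomputable def mulMatrix (e : Module.Basis (Fin 3) k L) : Lˣ →* GL (Fin 3) k :=
  Units.map (Algebra.leftMulMatrix e).toMonoidHom

omit [Finite k] in
theorem mulMatrix_smul (e : Module.Basis (Fin 3) k L) (u : Lˣ) (y : L) :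
    mulMatrix e u • e.equivFun y = e.equivFun (u * y) :=
  Algebra.leftMulMatrix_mulVec_repr e (u : L) y

omit [Finite k] in
theorem mk_mulMatrix_eq_one_iff (e : Module.Basis (Fin 3) k L) (u : Lˣ) :
    Matrix.ProjGenLinGroup.mk (mulMatrix e u) = 1 ↔ (u : L) ∈ (algebraMap k L).range := by
  rw [Matrix.ProjGenLinGroup.mk_eq_one, Matrix.GeneralLinearGroup.center_eq_range_scalar]
  constructor
  · rintro ⟨c, hc⟩
    have h1 := congrArg (fun M : GL (Fin 3) k => (M : Matrix (Fin 3) (Fin 3) k)) hc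
    refine ⟨c, Algebra.leftMulMatrix_injective e ?_⟩
    rw [AlgHom.commutes]
    exact h1
  · rintro ⟨c, hc⟩
    have hc0 : c ≠ 0 := by
      rintro rfl
      rw [map_zero] at hc
      exact u.ne_zero hc.symm
    refine ⟨Units.mk0 c hc0, Units.ext ?_⟩
    change Matrix.scalar (Fin 3) c = Algebra.leftMulMatrix e (u : L)
    rw [← hc, AlgHom.commutes]
    rfl

/-- The powers of a generator of the group `z ^ (s ^ 3 + 1) = 1` that lie in `k` are those whose
exponent is a multiple of `s ^ 2 - s + 1`. -/
theorem pow_mem_range_iff (hs3 : 3 ≤ s) (hk : Nat.card k = s ^ 2) (hL : Module.finrank k L = 3)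
    {ζ : L} (hζ : IsPrimitiveRoot ζ (s ^ 3 + 1)) (n : ℕ) :
    ζ ^ n ∈ (algebraMap k L).range ↔ s ^ 2 - s + 1 ∣ n := by
  obtain ⟨m, rfl⟩ : ∃ m, s = m + 1 := ⟨s - 1, by lia⟩
  have hN : (m + 1) ^ 2 - (m + 1) + 1 = m ^ 2 + m + 1 := by
    have : (m + 1) ^ 2 = m ^ 2 + m + (m + 1) := by ring
    rw [this, Nat.add_sub_cancel]
  have hζ0 : ζ ≠ 0 := hζ.ne_zero (by lia)
  have hq : (m + 1) ^ 2 = m * (m + 2) + 1 := by ring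
  have h3 : (m + 1) ^ 3 + 1 = (m ^ 2 + m + 1) * (m + 2) := by ring
  have hcop : Nat.Coprime (m ^ 2 + m + 1) m := by
    rw [show m ^ 2 + m + 1 = 1 + m * (m + 1) by ring]
    simp
  rw [hN]
  have h1 : ζ ^ n ∈ (algebraMap k L).range ↔ (ζ ^ n) ^ (m + 1) ^ 2 = ζ ^ n := by
    refine ⟨?_, mem_range_of_pow_eq hk hL⟩
    rintro ⟨c, hc⟩
    rw [← hc, algebraMap_pow_sq hk]
  have h2 : (ζ ^ n) ^ (m + 1) ^ 2 = ζ ^ n ↔ ζ ^ (n * m * (m + 2)) = 1 := by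
    rw [hq, pow_succ, ← pow_mul, ← mul_assoc]
    exact mul_eq_right₀ (pow_ne_zero _ hζ0)
  rw [h1, h2, hζ.pow_eq_one_iff_dvd, h3, Nat.mul_dvd_mul_iff_right (by lia)]
  exact ⟨hcop.dvd_of_dvd_mul_right, fun h => h.mul_right m⟩

/-- The points that come from the group `z ^ (s ^ 3 + 1) = 1`, in the coordinates of a basis. -/
def normOneArc (s : ℕ) (e : Module.Basis (Fin 3) k L) : Set (ℙ k (Fin 3 → k)) :=
  {P | ∃ z : L, z ^ (s ^ 3 + 1) = 1 ∧ ∃ h : e.equivFun z ≠ 0, P = Projectivization.mk k _ h}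

omit [Finite k] in
theorem equivFun_ne_zero (e : Module.Basis (Fin 3) k L) {y : L} (hy : y ≠ 0) :
    e.equivFun y ≠ 0 := by
  simpa using hy

omit [Finite k] in
theorem mk_equivFun_eq_iff (e : Module.Basis (Fin 3) k L) {w z : L}
    (hw : e.equivFun w ≠ 0) (hz : e.equivFun z ≠ 0) :
    Projectivization.mk k (e.equivFun w) hw = Projectivization.mk k (e.equivFun z) hz ↔
      Proportional k w z := by
  rw [Projectivization.mk_eq_mk_iff']
  refine exists_congr fun c => ?_
  rw [← map_smul, e.equivFun.injective.eq_iff, eq_comm]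

omit [Finite k] in
theorem mulMatrix_smul_mk (e : Module.Basis (Fin 3) k L) (u : Lˣ) {y : L}
    (hy : e.equivFun y ≠ 0) (huy : e.equivFun (u * y) ≠ 0) :
    mulMatrix e u • Projectivization.mk k (e.equivFun y) hy =
      Projectivization.mk k (e.equivFun (u * y)) huy := by
  rw [Projectivization.smul_mk]
  simp only [mulMatrix_smul]

theorem normOneArc_isArc (hk : Nat.card k = s ^ 2) (hL : Module.finrank k L = 3)
    (e : Module.Basis (Fin 3) k L) : IsArc (normOneArc s e) := by
  intro l
  by_contra! h
  have hfin : {P ∈ normOneArc s e | P.orthogonal l}.Finite := Set.toFinite _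
  rw [← hfin.cast_ncard_eq] at h
  have h' : 2 < {P ∈ normOneArc s e | P.orthogonal l}.ncard := by exact_mod_cast h
  obtain ⟨P₁, P₂, P₃, ⟨⟨z₁, hz₁, h₁, rfl⟩, o₁⟩, ⟨⟨z₂, hz₂, h₂, rfl⟩, o₂⟩,
    ⟨⟨z₃, hz₃, h₃, rfl⟩, o₃⟩, n₁₂, n₁₃, n₂₃⟩ := (Set.two_lt_ncard_iff hfin).1 h'
  rw [Ne, mk_equivFun_eq_iff] at n₁₂ n₁₃ n₂₃
  -- the line as a functional on `L`
  set φ : L →ₗ[k] k := (dotProductBilin k k).flip l.rep ∘ₗ e.equivFun.toLinearMap with hφ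
  have hφa : ∀ y, φ y = e.equivFun y ⬝ᵥ l.rep := fun y => rfl
  have hφ0 : φ ≠ 0 := by
    intro h0
    refine l.rep_nonzero (funext fun j => ?_)
    have := LinearMap.congr_fun h0 (e j)
    rw [hφa] at this
    simpa [Pi.single_apply, Finsupp.single_eq_pi_single] using this
  have ho : ∀ {z : L} (hz : e.equivFun z ≠ 0), (Projectivization.mk k _ hz).orthogonal l →
      φ z = 0 := by
    intro z hz ho
    rw [← l.mk_rep, Projectivization.orthogonal_mk] at ho
    exact ho
  rcases proportional_of_functional hk hL hz₁ hz₂ hz₃ hφ0 (ho h₁ o₁) (ho h₂ o₂) (ho h₃ o₃) with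
    h | h | h
  · exact n₁₂ h
  · exact n₁₃ h
  · exact n₂₃ h

omit [Finite k] in
/-- The points of the norm-one group form an orbit of the cyclic group generated by
multiplication by a generator. -/
theorem normOneArc_eq_orbit (e : Module.Basis (Fin 3) k L) {u : Lˣ}
    (hu : IsPrimitiveRoot (u : L) (s ^ 3 + 1)) :
    normOneArc s e = MulAction.orbit (Subgroup.zpowers (mulMatrix e u))
      (Projectivization.mk k _ (equivFun_ne_zero e one_ne_zero)) := by
  have hone : ∀ v : Lˣ, e.equivFun ((v : L) * 1) ≠ 0 := fun v =>
    equivFun_ne_zero e (by simp)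
  ext P
  constructor
  · rintro ⟨z, hz, h, rfl⟩
    have : NeZero (s ^ 3 + 1) := ⟨by lia⟩
    obtain ⟨i, -, rfl⟩ := hu.eq_pow_of_pow_eq_one hz
    refine ⟨⟨mulMatrix e u ^ i, Subgroup.pow_mem _ (Subgroup.mem_zpowers _) i⟩, ?_⟩
    change mulMatrix e u ^ i • Projectivization.mk k (e.equivFun (1 : L)) _ = _
    rw [← map_pow, mulMatrix_smul_mk e (u ^ i) _ (hone _)]
    simp only [Units.val_pow_eq_pow_val, mul_one]
  · rintro ⟨⟨_, i, rfl⟩, rfl⟩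
    refine ⟨(u ^ i : Lˣ), ?_, equivFun_ne_zero e (Units.ne_zero _), ?_⟩
    · have h1 : u ^ (s ^ 3 + 1) = 1 := Units.ext (by simpa using hu.pow_eq_one)
      rw [← Units.val_pow_eq_pow_val, ← zpow_natCast, ← zpow_mul, mul_comm, zpow_mul, zpow_natCast,
        h1, one_zpow, Units.val_one]
    · change mulMatrix e u ^ i • Projectivization.mk k (e.equivFun (1 : L)) _ = _
      rw [← map_zpow, mulMatrix_smul_mk e (u ^ i) _ (hone _)]
      simp only [mul_one]

theorem orderOf_mk_mulMatrix (hs3 : 3 ≤ s) (hk : Nat.card k = s ^ 2)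
    (hL : Module.finrank k L = 3) (e : Module.Basis (Fin 3) k L) {u : Lˣ}
    (hu : IsPrimitiveRoot (u : L) (s ^ 3 + 1)) :
    orderOf (Matrix.ProjGenLinGroup.mk (mulMatrix e u)) = s ^ 2 - s + 1 := by
  have h : ∀ n : ℕ, Matrix.ProjGenLinGroup.mk (mulMatrix e u) ^ n = 1 ↔ s ^ 2 - s + 1 ∣ n := by
    intro n
    rw [← map_pow, ← map_pow, mk_mulMatrix_eq_one_iff, Units.val_pow_eq_pow_val,
      pow_mem_range_iff hs3 hk hL hu]
  exact Nat.dvd_antisymm (orderOf_dvd_of_pow_eq_one ((h _).2 dvd_rfl))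
    ((h _).1 (pow_orderOf_eq_one _))

theorem ncard_normOneArc (hs3 : 3 ≤ s) (hk : Nat.card k = s ^ 2)
    (hL : Module.finrank k L = 3) (e : Module.Basis (Fin 3) k L) {u : Lˣ}
    (hu : IsPrimitiveRoot (u : L) (s ^ 3 + 1)) : (normOneArc s e).ncard = s ^ 2 - s + 1 := by
  have h : ∀ n : ℕ, Function.IsPeriodicPt (mulMatrix e u • ·) n
      (Projectivization.mk k _ (equivFun_ne_zero e (one_ne_zero (α := L)))) ↔
        s ^ 2 - s + 1 ∣ n := by
    intro n
    have h0 : e.equivFun (((u ^ n : Lˣ) : L) * 1) ≠ 0 := equivFun_ne_zero e (by simp)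
    rw [← pow_mem_range_iff hs3 hk hL hu, Function.IsPeriodicPt, Function.IsFixedPt, smul_iterate,
      ← map_pow]
    change mulMatrix e (u ^ n) • Projectivization.mk k (e.equivFun (1 : L)) _ = _ ↔ _
    rw [mulMatrix_smul_mk e (u ^ n) _ h0, mk_equivFun_eq_iff, mul_one, Units.val_pow_eq_pow_val]
    refine ⟨mem_range_of_proportional_one, ?_⟩
    rintro ⟨c, hc⟩
    exact ⟨c, by rw [← hc, Algebra.algebraMap_eq_smul_one]⟩
  rw [normOneArc_eq_orbit e hu, ← Nat.card_coe_set_eq,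
    Nat.card_congr (MulAction.orbitZPowersEquiv _ _), Nat.card_zmod]
  exact Nat.dvd_antisymm ((h _).2 dvd_rfl).minimalPeriod_dvd
    ((h _).1 (Function.isPeriodicPt_minimalPeriod _ _))

theorem frame_mulVec_map (hk : Nat.card k = s ^ 2) (f : Fin 3 → L) (c : Fin 3 → k) (i : Fin 3) :
    ∑ j, frame s f i j * algebraMap k L (c j) = (∑ j, c j • f j) ^ (s ^ 2) ^ (i : ℕ) := by
  simp only [frame_apply]
  generalize (i : ℕ) = n
  induction n with
  | zero => simp [Algebra.smul_def, mul_comm]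
  | succ n ih =>
    rw [pow_succ (s ^ 2) n, pow_mul, ← ih, ← frob_apply hk, map_sum]
    simp only [map_mul, AlgHom.commutes, frob_apply, ← pow_mul]

/-- Multiplication by an element with `z ^ (s ^ 3 + 1) = 1` is a unitary map. -/
theorem preservesHermitian_mulMatrix (hk : Nat.card k = s ^ 2) (hL : Module.finrank k L = 3)
    {e : Module.Basis (Fin 3) k L} (he : ∀ i j, hermForm k s (e i) (e j) = hermGram k i j) {u : Lˣ}
    (hu : (u : L) ^ (s ^ 3 + 1) = 1) : PreservesHermitian s (mulMatrix e u) := by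
  refine ⟨1, one_ne_zero, ?_⟩
  rw [C_1, one_mul]
  apply map_injective (algebraMap k L) (algebraMap k L).injective
  rw [map_bind₁, map_hermitian_eq hk hL he, map_formU]
  have hlin : ∀ i, bind₁ (fun i => map (algebraMap k L)
      (∑ j, C ((mulMatrix e u : Matrix (Fin 3) (Fin 3) k) i j) * X j)) (linForm (frame s e) i) =
      C ((u : L) ^ (s ^ 2) ^ (i : ℕ)) * linForm (frame s e) i := by
    intro i
    rw [bind₁_linForm]
    simp only [map_sum, map_mul, map_C, map_X, Finset.mul_sum, ← mul_assoc]
    simp only [← C_mul]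
    rw [Finset.sum_comm, linForm, Finset.mul_sum]
    refine Finset.sum_congr rfl fun j _ => ?_
    rw [← Finset.sum_mul, ← map_sum, ← mul_assoc, ← C_mul,
      frame_mulVec_map hk e (fun l => (mulMatrix e u : Matrix (Fin 3) (Fin 3) k) l j), frame_apply,
      ← mul_pow]
    congr 4
    have h1 : ∀ l, (mulMatrix e u : Matrix (Fin 3) (Fin 3) k) l j = e.repr (u * e j) l := fun l =>
      Algebra.leftMulMatrix_eq_repr_mul e (u : L) l j
    simp only [h1]
    exact e.sum_repr _
  obtain ⟨h₁, h₂, h₃⟩ := weights_of_pow_eq_one hu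
  simp only [hlin, Fin.isValue, Fin.coe_ofNat_eq_mod, Nat.zero_mod, Nat.one_mod,
    Nat.reduceMod, pow_zero, pow_one, ← pow_mul, Nat.reduceMul]
  refine formU_weights ?_ ?_ ?_ _ _ _
  · rw [← C_pow, ← C_mul, h₁, C_1]
  · rw [← C_pow, ← C_mul, h₂, C_1]
  · rw [← C_pow, ← C_mul, h₃, C_1]

/-- The projectivity from the coordinates of the Hermitian curve to those of the dual frame. -/
theorem exists_projectivity (hL : Module.finrank k L = 3) (e f : Module.Basis (Fin 3) k L) :
    ∃ T : GL (Fin 3) k, (fun P : ℙ k (Fin 3 → k) => T • P) '' normOneArc s e = dualArc s f := by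
  set A : (Fin 3 → k) →ₗ[k] (Fin 3 → k) := dualPoint f ∘ₗ e.equivFun.symm.toLinearMap with hA
  have hinj : Function.Injective A := (dualPoint_injective hL f).comp e.equivFun.symm.injective
  have hdet : (LinearMap.toMatrix' A).det ≠ 0 := by
    rw [LinearMap.det_toMatrix']
    exact (LinearEquiv.ofInjectiveEndo A hinj).isUnit_det'.ne_zero
  set T := Matrix.GeneralLinearGroup.mkOfDetNeZero _ hdet with hT
  have hTv : ∀ y : L, T • e.equivFun y = dualPoint f y := by
    intro y
    change (LinearMap.toMatrix' A).mulVec (e.equivFun y) = _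
    rw [LinearMap.toMatrix'_mulVec]
    simp [hA]
  refine ⟨T, ?_⟩
  ext P
  constructor
  · rintro ⟨_, ⟨z, hz, h, rfl⟩, rfl⟩
    refine ⟨z, hz, dualPoint_ne_zero hL f (ne_zero_of_pow_eq_one hz), ?_⟩
    simp only [Projectivization.smul_mk, hTv]
  · rintro ⟨z, hz, h, rfl⟩
    refine ⟨_, ⟨z, hz, equivFun_ne_zero e (ne_zero_of_pow_eq_one hz), rfl⟩, ?_⟩
    simp only [Projectivization.smul_mk, hTv]

theorem exists_primitiveRoot_of_dvd {E : Type*} [Field E] [Finite E] {n d : ℕ}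
    (h : d * n + 1 = Nat.card E) : ∃ a : E, IsPrimitiveRoot a n := by
  obtain ⟨g, hg⟩ := IsCyclic.exists_ofOrder_eq_natCard (α := Eˣ)
  have hcard : orderOf g = d * n := by
    have := Nat.card_units E
    lia
  have h0 : d * n ≠ 0 := by
    rw [← hcard]
    exact (orderOf_pos g).ne'
  have h1 : IsPrimitiveRoot (g ^ d) n := by
    have := (IsPrimitiveRoot.orderOf g).pow (orderOf_pos g) hcard
    exact this
  exact ⟨(g ^ d : Eˣ), IsPrimitiveRoot.coe_units_iff.2 h1⟩

theorem isEnvelopeOfInvariantArc (hs3 : 3 ≤ s) (hs : Odd s) (hk : Nat.card k = s ^ 2)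
    (hL : Module.finrank k L = 3) {e : Module.Basis (Fin 3) k L}
    (he : ∀ i j, hermForm k s (e i) (e j) = hermGram k i j) (f : Module.Basis (Fin 3) k L)
    {F : MvPolynomial (Fin 3) k}
    (hF : map (algebraMap k L) F = formG s (linForm (frame s f) 0) (linForm (frame s f) 1)
      (linForm (frame s f) 2)) (hF0 : F ≠ 0) (hFh : F.IsHomogeneous (2 * (s + 1))) :
    IsEnvelopeOfInvariantArc s F := by
  have := finite_of_finrank hL
  obtain ⟨ζ, hζ⟩ : ∃ ζ : L, IsPrimitiveRoot ζ (s ^ 3 + 1) := by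
    obtain ⟨m, hm⟩ := Nat.exists_eq_add_one_of_ne_zero (pow_ne_zero 3 (by lia : s ≠ 0))
    refine exists_primitiveRoot_of_dvd (d := m) ?_
    rw [card_cubic hk hL, show s ^ 6 = (s ^ 3) ^ 2 by ring, hm]
    ring
  obtain ⟨u, rfl⟩ : ∃ u : Lˣ, (u : L) = ζ := ⟨Units.mk0 ζ (hζ.ne_zero (by lia)), rfl⟩
  obtain ⟨T, hT⟩ := exists_projectivity (s := s) hL e f
  have hcard := ncard_normOneArc hs3 hk hL e hζ
  refine ⟨mulMatrix e u, T, normOneArc s e, preservesHermitian_mulMatrix hk hL he hζ.pow_eq_one,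
    orderOf_mk_mulMatrix hs3 hk hL e hζ, ⟨_, normOneArc_eq_orbit e hζ⟩, normOneArc_isArc hk hL e,
    hcard, ?_⟩
  rw [hT]
  refine isAlgebraicEnvelope_dualArc hs3 hs hk hL f hF hF0 hFh ?_
  rw [← hT, (MulAction.injective T).injOn.ncard_image, hcard]

end SingerGroup

/-! ### The change of frame -/

section Frame

variable {k L : Type*} [Field k] [Finite k] [Field L] [Algebra k L] {s : ℕ}

omit [Finite k] in
theorem det_frameMatrix (q : ℕ) (a : L) : (frameMatrix q a).det =
    a ^ 3 + 1 + (a ^ (q + 1)) ^ 3 - 3 * (a * a ^ (q + 1)) := by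
  rw [frameMatrix, Matrix.det_fin_three]
  simp
  ring

/-- The difference of the determinants for `a` and, up to a factor, `a⁻¹` is `(a - a ^ q) ^ 3`, so
that one of the two matrices is non-singular. -/
theorem exists_primitiveRoot_det_ne_zero (hs3 : 3 ≤ s) (hk : Nat.card k = s ^ 2)
    (hL : Module.finrank k L = 3) : ∃ a : L, IsPrimitiveRoot a ((s ^ 2) ^ 2 + s ^ 2 + 1) ∧
      (frameMatrix (s ^ 2) a).det ≠ 0 := by
  have := finite_of_finrank hL
  obtain ⟨m, hm⟩ := Nat.exists_eq_add_one_of_ne_zero (pow_ne_zero 2 (by lia : s ≠ 0))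
  obtain ⟨a, ha⟩ : ∃ a : L, IsPrimitiveRoot a ((s ^ 2) ^ 2 + s ^ 2 + 1) := by
    refine exists_primitiveRoot_of_dvd (d := m) ?_
    rw [card_cubic hk hL, show s ^ 6 = (s ^ 2) ^ 3 by ring, hm]
    ring
  have ha0 : a ≠ 0 := ha.ne_zero (by lia)
  by_cases h : (frameMatrix (s ^ 2) a).det = 0
  · refine ⟨a⁻¹, ha.inv, fun h' => ?_⟩
    rw [det_frameMatrix] at h h'
    have hb0 : a ^ s ^ 2 ≠ 0 := pow_ne_zero _ ha0
    have h1 : (a - a ^ s ^ 2) ^ 3 = 0 := by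
      simp only [pow_succ a, inv_pow] at h h'
      generalize a ^ s ^ 2 = b at *
      field_simp at h'
      linear_combination h - h'
    have h2 : a ^ s ^ 2 = a := (sub_eq_zero.1 (pow_eq_zero_iff three_ne_zero |>.1 h1)).symm
    have h3 : a ^ m = 1 := by
      rw [hm, pow_succ] at h2
      exact mul_right_cancel₀ ha0 (h2.trans (one_mul a).symm)
    have h4 := Nat.le_of_dvd (by
      have : 3 ^ 2 ≤ s ^ 2 := Nat.pow_le_pow_left hs3 2
      lia) (ha.dvd_of_pow_eq_one m h3)
    lia
  · exact ⟨a, ha, h⟩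

/-- Up to a common factor `b` with `b ^ (q - 1) = a`, the rows of the matrix of the change of frame
are the conjugates of its first row. -/
theorem exists_frame_eq (hs3 : 3 ≤ s) (hk : Nat.card k = s ^ 2) (hL : Module.finrank k L = 3)
    {a : L} (ha : a ^ ((s ^ 2) ^ 2 + s ^ 2 + 1) = 1) :
    ∃ b : L, b ≠ 0 ∧ frame s (fun j => b * frameMatrix (s ^ 2) a 0 j) =
      b • frameMatrix (s ^ 2) a := by
  have := finite_of_finrank hL
  obtain ⟨m, hm⟩ := Nat.exists_eq_add_one_of_ne_zero (pow_ne_zero 2 (by lia : s ≠ 0))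
  obtain ⟨b, hb0, hb⟩ := exists_pow_eq_of_pow_eq_one (d := m) (e := (s ^ 2) ^ 2 + s ^ 2 + 1) (by
    rw [card_cubic hk hL, show s ^ 6 = (s ^ 2) ^ 3 by ring, hm]
    ring) ha (by lia)
  have hbq : b ^ s ^ 2 = a * b := by rw [hm, pow_succ, hb]
  set q := s ^ 2 with hq
  have ha' : a ^ q ^ 2 * a ^ q * a = 1 := by rw [← ha, ← pow_add, ← pow_succ]
  have haq : (a ^ (q + 1)) ^ q = a ^ q ^ 2 * a ^ q := by
    rw [← pow_mul, ← pow_add]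
    congr 1
    ring
  refine ⟨b, hb0, ?_⟩
  -- the action of the Frobenius map on the three entries
  have r0 : (b * a) ^ q = b * a ^ (q + 1) := by
    rw [mul_pow, hbq]
    ring
  have r1 : (b * a ^ (q + 1)) ^ q = b := by
    rw [mul_pow, hbq, haq]
    linear_combination b * ha'
  have r2 : b ^ q = b * a := by rw [hbq, mul_comm]
  ext i j
  rw [frame_apply, Matrix.smul_apply, smul_eq_mul, ← hq]
  fin_cases i <;> fin_cases j <;> simp [frameMatrix, pow_mul, pow_two q, r0, r1, r2]

theorem isHomogeneous_formG {A : Type*} [CommRing A] {x₀ x₁ x₂ : MvPolynomial (Fin 3) A}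
    (h₀ : x₀.IsHomogeneous 1) (h₁ : x₁.IsHomogeneous 1) (h₂ : x₂.IsHomogeneous 1) :
    (formG s x₀ x₁ x₂).IsHomogeneous (2 * (s + 1)) := by
  have hA : (x₁ * x₂ ^ s).IsHomogeneous (s + 1) := by
    simpa [add_comm] using h₁.mul (h₂.pow s)
  have hB : (x₀ * x₁ ^ s).IsHomogeneous (s + 1) := by
    simpa [add_comm] using h₀.mul (h₁.pow s)
  have hC : (x₀ ^ s * x₂).IsHomogeneous (s + 1) := by
    simpa [add_comm] using (h₀.pow s).mul h₂
  rw [formG_eq, two_mul]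
  exact ((hA.mul ((hA.sub hB).sub hC)).add (hB.mul ((hB.sub hA).sub hC))).add
    (hC.mul ((hC.sub hA).sub hB))

theorem two_ne_zero_of_algebra (E : Type*) [Field E] [Algebra k E] (hs : Odd s)
    (hk : Nat.card k = s ^ 2) : (2 : E) ≠ 0 := by
  intro h
  apply two_ne_zero_of_card hs hk
  apply (algebraMap k E).injective
  rw [map_ofNat, h, map_zero]

/-- The conjugate linear forms of a basis give a form over `k` with all the required properties. -/
theorem exists_form_of_basis (hs3 : 3 ≤ s) (hs : Odd s) (hk : Nat.card k = s ^ 2)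
    (hL : Module.finrank k L = 3) (f : Module.Basis (Fin 3) k L) :
    ∃ F : MvPolynomial (Fin 3) k,
      map (algebraMap k L) F = formG s (linForm (frame s f) 0) (linForm (frame s f) 1)
        (linForm (frame s f) 2) ∧
      F.IsHomogeneous (2 * (s + 1)) ∧ IsPlaneModel F (hermitian k s) ∧ IsSingularCurve F ∧
      IsEnvelopeOfInvariantArc s F := by
  have := module_finite_of_finrank hL
  have h2L := two_ne_zero_of_algebra L hs hk
  have h2k := two_ne_zero_of_algebra (AlgebraicClosure k) hs hk
  obtain ⟨e, he⟩ := exists_hermitian_basis (L := L) hs3 hs hk hL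
  obtain ⟨M', hM'⟩ := frame_mul_eq_one hk hL e
  obtain ⟨N', hN'⟩ := frame_mul_eq_one hk hL f
  have hMc := isCyclicFrame_frame hk hL e
  have hNc := isCyclicFrame_frame hk hL f
  have hfix := fixed_mem_range hk hL
  have hH := map_hermitian_eq hk hL he
  obtain ⟨F, hF⟩ := exists_map_eq_of_fixed hfix (p := formG s (linForm (frame s f) 0)
    (linForm (frame s f) 1) (linForm (frame s f) 2)) (by
      rw [map_formG, hNc.map_linForm, hNc.map_linForm, hNc.map_linForm]
      exact formG_cyclic _ _ _ _)
  have hFh : F.IsHomogeneous (2 * (s + 1)) := by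
    apply IsHomogeneous.of_map (algebraMap k L).injective
    rw [hF]
    exact isHomogeneous_formG (isHomogeneous_linForm _ _) (isHomogeneous_linForm _ _)
      (isHomogeneous_linForm _ _)
  let ι : L →ₐ[k] AlgebraicClosure k := IsAlgClosed.lift
  have hFirr := irreducible_map_of_formG ι hs (by lia) h2k hN' hF
  have hHirr := irreducible_map_of_formU ι (by lia) hM' hH
  have hF0 : F ≠ 0 := by
    rintro rfl
    rw [map_zero] at hFirr
    exact not_irreducible_zero hFirr
  refine ⟨F, hF, hFh, ⟨⟨⟨_, hFh⟩, hFirr⟩, ⟨⟨_, isHomogeneous_hermitian k s⟩, hHirr⟩, ?_⟩,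
    isSingularCurve_of_formG (by lia) hN' hF,
    isEnvelopeOfInvariantArc hs3 hs hk hL he f hF hF0 hFh⟩
  obtain ⟨r, rfl⟩ := hs
  exact exists_rationalMap_leftInverse (by lia) h2L hfix hMc hM' hNc hN' hF hH

end Frame

end HermitianModel

theorem proposition4p1p1 {k L : Type*} [Field k] [Finite k] [Field L] [Algebra k L]
    (s : ℕ) (hs : Odd s) (hk : Nat.card k = s ^ 2) (hL : Module.finrank k L = 3) :
    (∃ a : L, IsPrimitiveRoot a ((s ^ 2) ^ 2 + s ^ 2 + 1) ∧
      (HermitianModel.frameMatrix (s ^ 2) a).det ≠ 0) ∧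
    ∀ a : L, IsPrimitiveRoot a ((s ^ 2) ^ 2 + s ^ 2 + 1) →
      (HermitianModel.frameMatrix (s ^ 2) a).det ≠ 0 →
      ∃ (c : L) (F : MvPolynomial (Fin 3) k), c ≠ 0 ∧
        HermitianModel.formH s a =
          MvPolynomial.C c * MvPolynomial.map (algebraMap k L) F ∧
        F.IsHomogeneous (2 * (s + 1)) ∧
        HermitianModel.IsPlaneModel F (HermitianModel.hermitian k s) ∧
        HermitianModel.IsSingularCurve F ∧
        HermitianModel.IsEnvelopeOfInvariantArc s F := by
  open HermitianModel in
  have hs3 := three_le_of_card hs hk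
  refine ⟨exists_primitiveRoot_det_ne_zero hs3 hk hL, fun a ha hdet => ?_⟩
  obtain ⟨b, hb0, hb⟩ := exists_frame_eq hs3 hk hL ha.pow_eq_one
  have hunit : IsUnit (frameMatrix (s ^ 2) a).det := Ne.isUnit hdet
  obtain ⟨f, hf⟩ := basis_of_linearIndependent hL (linearIndependent_of_frame hk
    (f := fun j => b * frameMatrix (s ^ 2) a 0 j) (N' := b⁻¹ • (frameMatrix (s ^ 2) a)⁻¹) (by
      rw [hb, Matrix.smul_mul, Matrix.mul_smul, Matrix.nonsing_inv_mul _ hunit, smul_smul,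
        inv_mul_cancel₀ hb0, one_smul]))
  obtain ⟨F, hF, hFh, hmodel, hsing, henv⟩ := exists_form_of_basis hs3 hs hk hL f
  have hbc : b ^ (2 * (s + 1)) ≠ 0 := pow_ne_zero _ hb0
  refine ⟨(b ^ (2 * (s + 1)))⁻¹, F, inv_ne_zero hbc, ?_, hFh, hmodel, hsing, henv⟩
  have hlin : ∀ i, linForm (frame s f) i =
      MvPolynomial.C b * linForm (frameMatrix (s ^ 2) a) i := by
    intro i
    rw [hf, hb]
    simp only [linForm, Matrix.smul_apply, smul_eq_mul, Finset.mul_sum, map_mul, mul_assoc]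
  have hH : formH s a = formG s (linForm (frameMatrix (s ^ 2) a) 0)
      (linForm (frameMatrix (s ^ 2) a) 1) (linForm (frameMatrix (s ^ 2) a) 2) := by
    simp [formH, linForm, frameMatrix, Fin.sum_univ_three]
  rw [hF, hlin, hlin, hlin, formG_smul, ← hH, ← MvPolynomial.C_pow, ← mul_assoc,
    ← MvPolynomial.C_mul, inv_mul_cancel₀ hbc, MvPolynomial.C_1, one_mul]
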